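/- Let $K$ be a commutative semiring in which countable sums are defined and satisfy the usual laws (empty, one-element and two-element sums are as expected, sums may be partitioned into blocks, and multiplication distributes over them); every commutative $\omega$-continuous semiring is an example. A *weighted linear indexed grammar* (WLIG) over $K$ consists of finite sets of nonterminals $\mathcal N$, terminals $\Sigma$ and stack symbols $\Gamma$, a start symbol $S\in\mathcal N$ with an initial stack $\sigma_{\mathrm{init}}\in\Gamma^*$, and a finite set of productions, each with a weight in $K$, of the forms $X[\cdot\cdot\,\alpha]\to\Upsilon\,X'[\cdot\cdot\,\alpha']\,\Upsilon'$ or $X[\alpha]\to a$, where $X,X'\in\mathcal N$, $\alpha,\alpha'\in\Gamma^*$, $a\in\Sigma\cup\{\varepsilon\}$, and $\Upsilon,\Upsilon'$ are strings of terminals and of nonterminals with stacks. A production of the first form rewrites $X[\rho\alpha]$ to $\Upsilon\,X'[\rho\alpha']\,\Upsilon'$ for any $\rho\in\Gamma^*$; one of the second form rewrites $X[\alpha]$ to $a$. The grammar is *top-down* if there is $S_0\in\Gamma$ such that $\sigma_{\mathrm{init}}=S_0$, every nonterminal in $\Upsilon,\Upsilon'$ carries the stack $[S_0]$, and every left-hand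 stack $\alpha$ is a single symbol. A production is *nullary* if it has the form $X[A]\to\varepsilon$ with $A\in\Gamma$. The *language* of $G$ is the set of strings $y\in\Sigma^*$ with $S[\sigma_{\mathrm{init}}]\Rightarrow^* y$. The *stringsum* of $y$ is the sum, over all leftmost derivations of $y$ from $S[\sigma_{\mathrm{init}}]$ (equivalently, over all derivation trees), of the product of the weights of the productions used. Two WLIGs with the same terminals are *weakly equivalent* if they have the same language and every $y\in\Sigma^*$ has the same stringsum in both. **Proposition.** Every top-down WLIG $G$ over $K$ is weakly equivalent to a top-down WLIG $G'$, over the same terminal alphabet, that has no nullary productions except possibly the production $S'[\sigma'_{\mathrm{init}}]\to\varepsilon$ for its start symbol $S'$ and initial stack $\sigma'_{\mathrm{init}}$, and in which $S'$ does not occur on the right-hand side of any production. If $\varepsilon$ is not in the language of $G$, then $G'$ has no nullary productions at all. -/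

import Mathlib

/-- A countably complete commutative semiring: a commutative semiring in which every countable
family has a sum. Empty, one-element and two-element sums are the usual ones, sums may be computed
blockwise along any partition of the index set, and multiplication distributes over all sums.
Every `ω`-continuous commutative semiring is of this kind. -/
class CountablyCompleteSemiring (K : Type*) extends CommSemiring K where
  /-- The sum of a countable family. -/
  csum : {ι : Type} → [Countable ι] → (ι → K) → K
  csum_empty : ∀ {ι : Type} [IsEmpty ι] (f : ι → K), csum f = 0
  csum_unique : ∀ {ι : Type} [Unique ι] (f : ι → K), csum f = f default
  csum_bool : ∀ f : Bool → K, csum f = f true + f false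
  csum_partition : ∀ {ι κ : Type} [Countable ι] [Countable κ] (g : ι → κ) (f : ι → K),
    csum f = csum fun k : κ => csum fun i : {i : ι // g i = k} => f i.1
  mul_csum : ∀ {ι : Type} [Countable ι] (a : K) (f : ι → K),
    a * csum f = csum fun i => a * f i

/-- A symbol of a sentential form: a terminal, or a nonterminal augmented with a stack.
Stacks are written from bottom to top, so the top of the stack is the end of the list. -/
inductive FormSymbol (N T Γ : Type) where
  | term (a : T)
  | nonterm (X : N) (σ : List Γ)

/-- Production rules of a linear indexed grammar.
* `inherit X α Υ X' α' Υ'` is `X[.. α] → Υ X'[.. α'] Υ'`;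
* `terminal X α (some a)` is `X[α] → a`, and `terminal X α none` is `X[α] → ε`. -/
inductive Production (N T Γ : Type) where
  | inherit (X : N) (α : List Γ) (l : List (FormSymbol N T Γ)) (X' : N) (α' : List Γ)
      (r : List (FormSymbol N T Γ))
  | terminal (X : N) (α : List Γ) (a : Option T)

namespace Production

variable {N T Γ : Type}

/-- `p.Rewrites X σ γ`: applying `p` to the nonterminal `X[σ]` replaces it by `γ`. -/
inductive Rewrites : Production N T Γ → N → List Γ → List (FormSymbol N T Γ) → Prop
  | inherit (X : N) (α : List Γ) (l : List (FormSymbol N T Γ)) (X' : N) (α' : List Γ)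
      (r : List (FormSymbol N T Γ)) (rest : List Γ) :
      Rewrites (.inherit X α l X' α' r) X (rest ++ α)
        (l ++ FormSymbol.nonterm X' (rest ++ α') :: r)
  | terminal (X : N) (α : List Γ) (a : Option T) :
      Rewrites (.terminal X α a) X α (a.toList.map FormSymbol.term)

/-- `p` is nullary, i.e. of the form `X[A] → ε`. -/
def IsNullary (p : Production N T Γ) : Prop :=
  ∃ (X : N) (A : Γ), p = .terminal X [A] none

/-- The nonterminal `Y` occurs (with some stack) on the right-hand side of the production. -/
def OccursOnRight (Y : N) : Production N T Γ → Prop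
  | .inherit _ _ l X' _ r => Y = X' ∨ ∃ σ, FormSymbol.nonterm Y σ ∈ l ++ r
  | .terminal _ _ _ => False

end Production

/-- A weighted linear indexed grammar with terminal alphabet `T` and weights in `K`. -/
structure WLIG (T : Type) (K : Type*) where
  /-- nonterminal symbols -/
  N : Type
  /-- stack symbols -/
  Γ : Type
  finite_N : Finite N
  finite_Γ : Finite Γ
  /-- production rules -/
  rules : Finset (Production N T Γ)
  /-- start symbol -/
  start : N
  /-- initial stack -/
  initStack : List Γ
  /-- production weights -/
  weight : rules → K

namespace WLIG

variable {T : Type} {K : Type*}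

/-- Sentential forms. -/
abbrev Form (G : WLIG T K) : Type := List (FormSymbol G.N T G.Γ)

/-- The string `y` as a sentential form. -/
def ofString (G : WLIG T K) (y : List T) : G.Form := y.map FormSymbol.term

/-- The sentential form `S[σ_init]`. -/
def initForm (G : WLIG T K) : G.Form := [FormSymbol.nonterm G.start G.initStack]

/-- `β ⇒ β'`: some production is applied to some nonterminal of `β`. -/
inductive Step (G : WLIG T K) : G.Form → G.Form → Prop
  | mk (p : G.rules) (Ψ Ψ' : G.Form) (X : G.N) (σ : List G.Γ) (γ : G.Form)
      (h : p.1.Rewrites X σ γ) :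
      Step G (Ψ ++ FormSymbol.nonterm X σ :: Ψ') (Ψ ++ γ ++ Ψ')

/-- The language of `G`: the strings `y` with `S[σ_init] ⇒* y`. -/
def language (G : WLIG T K) : Set (List T) :=
  {y | Relation.ReflTransGen G.Step G.initForm (G.ofString y)}

/-- `G.LeftmostDerives β d y`: applying the productions in `d` one after another, each to the
leftmost nonterminal of the current sentential form, leads from `β` to the string `y`. -/
inductive LeftmostDerives (G : WLIG T K) : G.Form → List G.rules → List T → Prop
  | nil (y : List T) : LeftmostDerives G (G.ofString y) [] y
  | cons (p : G.rules) (u : List T) (Ψ' : G.Form) (X : G.N) (σ : List G.Γ) (γ : G.Form)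
      (d : List G.rules) (y : List T) (h : p.1.Rewrites X σ γ)
      (hd : LeftmostDerives G (G.ofString u ++ γ ++ Ψ') d y) :
      LeftmostDerives G (G.ofString u ++ FormSymbol.nonterm X σ :: Ψ') (p :: d) y

/-- The derivations of the string `y`. Two derivations that differ only in the order in which
independent nonterminals are rewritten (i.e. with the same derivation tree) count as one;
each class is represented by its leftmost member, and that by its sequence of productions, which
determines the sentential forms. -/
def Derivation (G : WLIG T K) (y : List T) : Type :=
  {d : List G.rules // G.LeftmostDerives G.initForm d y}

instance (G : WLIG T K) (y : List T) : Countable (G.Derivation y) :=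
  inferInstanceAs (Countable {d : List G.rules // G.LeftmostDerives G.initForm d y})

/-- The weight of a derivation: the product of the weights of its productions. -/
def derivationWeight [CommSemiring K] (G : WLIG T K) {y : List T} (d : G.Derivation y) : K :=
  (d.1.map G.weight).prod

/-- The stringsum of `y`: the total weight of all derivations of `y`. -/
def stringsum [CountablyCompleteSemiring K] (G : WLIG T K) (y : List T) : K :=
  CountablyCompleteSemiring.csum fun d : G.Derivation y => G.derivationWeight d

/-- Weak equivalence: same language and same weight for every string. -/
def WeaklyEquivalent [CountablyCompleteSemiring K] (G G' : WLIG T K) : Prop :=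
  G.language = G'.language ∧ ∀ y : List T, G.stringsum y = G'.stringsum y

/-- `G` is top-down: for some stack symbol `S₀` the initial stack is `[S₀]`, and every production
is `X[.. A] → Υ X'[.. α] Υ'`, where all nonterminals in `Υ` and `Υ'` carry the stack `[S₀]`,
or `X[A] → a` with `a` a terminal or `ε`. -/
def IsTopDown (G : WLIG T K) : Prop :=
  ∃ S₀ : G.Γ, G.initStack = [S₀] ∧ ∀ p ∈ G.rules,
    (∃ X A l X' α r, p = .inherit X [A] l X' α r ∧
      ∀ Y σ, FormSymbol.nonterm Y σ ∈ l ++ r → σ = [S₀]) ∨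
    (∃ X A a, p = .terminal X [A] a)

end WLIG

/-!
The proof replaces bijections between derivations by systems of equations with unique solutions.

Each production of `G` gets the weight `C k * X` in the power series over `WithZero K`, where `k` is
its weight in `K`; the variable `X` counts productions. These power series form a countably complete
semiring again, `evalOne` (followed by `unzero`) is a homomorphism that leads back to `K`, and a
stringsum in `WithZero K` vanishes only if there is no derivation at all, so that one computation
settles the stringsums and the language (`mem_language_iff_derivSum_ne_zero`). The series
`derivSum w β` of the total weights of the derivations from a form `β` is multiplicative in `β`
(`derivSum_append`) and satisfies one linear equation for each nonterminal with a stack. As the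
weights have no constant term, the equations determine it (`derivSum_eq_formVal`). To prove
the new grammar correct, it is thus enough to guess its derivation sums and to check its equations.

In the new grammar the bottom symbol of every stack is marked. The nonterminal `keep Y` derives the
nonempty part of what `Y` derives. For a production `Y[.. A] → l Z[.. α] r`, the nonterminals in `l`
and `r` that derive the empty string are deleted, at the cost of their total null weight. If the
spine child `Z[.. α]` derives a nonempty string, it remains the spine child, as `keep Z`. If it
derives the empty string, then some symbol of `l` and `r` remains, and the first such symbol `s`
becomes the spine child. It must not see the inherited stack, whence the nonterminal `drain Z s`: it
empties the stack symbol by symbol with the weights with which `Z` derives the empty string from it,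
and turns into `s` on reaching the marked bottom symbol. These weights factor along the stack,
because a derivation of the empty string from `Z[ρ σ]` pops `σ` before it touches `ρ`
(`IsPopWeight.nullWeight_append_stack`); the pop weights themselves are obtained as the fixed point
of a contraction (`exists_isPopWeight`). The new start symbol adds the production for the empty
string. The equations of the new grammar are verified in `linearCombination_trimRules`.

The productions of the new grammar are the support of a finitely supported function from productions
to weights. Thus equal productions of different origin are merged with their weights added up, and
productions that no derivation of `G` accounts for do not appear.
-/

open PowerSeries

/-! ### Sums over countable families -/

namespace CountablyCompleteSemiring

variable {K : Type*} [CountablyCompleteSemiring K]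

theorem csum_congr {ι : Type} [Countable ι] {f g : ι → K} (h : ∀ i, f i = g i) :
    csum f = csum g := by
  rw [funext h]

/-- Sums may be reindexed: a bijection is a partition into one-element blocks. -/
theorem csum_equiv {ι κ : Type} [Countable ι] [Countable κ] (e : ι ≃ κ) (f : κ → K) :
    csum (fun i => f (e i)) = csum f := by
  rw [csum_partition e]
  refine csum_congr fun k => ?_
  let _ : Unique {i : ι // e i = k} :=
    ⟨⟨⟨e.symm k, e.apply_symm_apply k⟩⟩, fun i => Subtype.ext ((e.eq_symm_apply).2 i.2)⟩
  rw [csum_unique]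
  exact congrArg f (e.apply_symm_apply k)

theorem csum_sigma {κ : Type} [Countable κ] {β : κ → Type} [∀ k, Countable (β k)]
    (f : (Σ k, β k) → K) : csum f = csum fun k => csum fun b : β k => f ⟨k, b⟩ := by
  rw [csum_partition (fun x : Σ k, β k => x.1)]
  refine csum_congr fun k => ?_
  exact (csum_equiv (Equiv.sigmaSubtype k).symm
    (fun i : {x : Σ k, β k // x.1 = k} => f i.1)).symm

theorem csum_prod {ι κ : Type} [Countable ι] [Countable κ] (f : ι × κ → K) :
    csum f = csum fun i => csum fun k => f (i, k) := by
  rw [← csum_equiv (Equiv.sigmaEquivProd ι κ), csum_sigma]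
  rfl

theorem csum_comm {ι κ : Type} [Countable ι] [Countable κ] (f : ι → κ → K) :
    csum (fun i => csum fun k => f i k) = csum fun k => csum fun i => f i k := by
  rw [← csum_prod fun x : ι × κ => f x.1 x.2, ← csum_prod fun x : κ × ι => f x.2 x.1,
    ← csum_equiv (Equiv.prodComm ι κ)]
  rfl

theorem csum_zero {ι : Type} [Countable ι] : csum (fun _ : ι => (0 : K)) = 0 := by
  have h := mul_csum (0 : K) (fun _ : ι => (0 : K))
  simpa using h.symm

theorem csum_add {ι : Type} [Countable ι] (f g : ι → K) :
    csum (fun i => f i + g i) = csum f + csum g := by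
  have h := csum_comm (fun (i : ι) (b : Bool) => cond b (f i) (g i))
  simpa only [csum_bool, cond_true, cond_false] using h

theorem csum_finset_sum {ι α : Type} [Countable ι] (s : Finset α) (f : α → ι → K) :
    csum (fun i => ∑ a ∈ s, f a i) = ∑ a ∈ s, csum (f a) := by
  classical
  induction s using Finset.induction_on with
  | empty => simpa using csum_zero
  | insert a s ha ih => simp only [Finset.sum_insert ha, csum_add, ih]

theorem csum_sum {ι κ : Type} [Countable ι] [Countable κ] (f : ι ⊕ κ → K) :
    csum f = csum (fun i => f (.inl i)) + csum fun k => f (.inr k) := by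
  have h (b : Bool) : Countable (bif b then κ else ι) := by cases b <;> assumption
  rw [← csum_equiv (Equiv.sumEquivSigmaBool ι κ).symm, csum_sigma, csum_bool, add_comm]
  rfl

theorem csum_eq_single {ι : Type} [Countable ι] {f : ι → K} (i : ι) (h : ∀ j, j ≠ i → f j = 0) :
    csum f = f i := by
  classical
  rw [csum_partition fun j => decide (j = i), csum_bool]
  let _ : Unique {j : ι // decide (j = i) = true} :=
    ⟨⟨⟨i, decide_eq_true rfl⟩⟩, fun j => Subtype.ext (of_decide_eq_true j.2)⟩
  rw [csum_unique, csum_congr (g := fun _ => 0), csum_zero, add_zero]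
  · rfl
  · exact fun j => h _ (of_decide_eq_false j.2)

/-- On finite families the countable sum is the sum of the semiring. -/
theorem csum_fintype {ι : Type} [Fintype ι] (f : ι → K) : csum f = ∑ i, f i := by
  revert f
  refine Fintype.induction_empty_option (P := fun ι _ => ∀ f : ι → K, csum f = ∑ i, f i)
    ?_ ?_ ?_ ι
  · intro α β _ e ih f
    let _ := Fintype.ofEquiv β e.symm
    rw [← csum_equiv e, ih, ← e.sum_comp]
  · intro f
    simp [csum_empty]
  · intro α _ ih f
    rw [← csum_equiv (Equiv.optionEquivSumPUnit α).symm, csum_sum, ih, csum_unique,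
      Fintype.sum_option, add_comm]
    rfl

theorem csum_mul {ι : Type} [Countable ι] (f : ι → K) (a : K) :
    csum f * a = csum fun i => f i * a := by
  simp only [mul_comm _ a, mul_csum]

/-! ### Adjoining a new zero -/

/-- The map that identifies the adjoined zero with the zero of `K`. -/
def unzero : WithZero K →+* K where
  toFun x := WithZero.recZeroCoe 0 id x
  map_zero' := rfl
  map_one' := rfl
  map_add' x y := by
    induction x using WithZero.recZeroCoe <;> induction y using WithZero.recZeroCoe
    all_goals simp [← WithZero.coe_add]
  map_mul' x y := by
    induction x using WithZero.recZeroCoe <;> induction y using WithZero.recZeroCoe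
    all_goals simp [← WithZero.coe_mul]

@[simp] theorem unzero_coe (k : K) : unzero (k : WithZero K) = k := rfl

/-- An element of `WithZero K` is determined by its image in `K` and by whether it is zero. -/
theorem withZero_ext {x y : WithZero K} (h : unzero x = unzero y) (h0 : x = 0 ↔ y = 0) :
    x = y := by
  induction x using WithZero.recZeroCoe <;> induction y using WithZero.recZeroCoe
  · rfl
  · simp at h0
  · simp at h0
  · simpa using h

theorem withZero_add_eq_zero {x y : WithZero K} : x + y = 0 ↔ x = 0 ∧ y = 0 := by
  induction x using WithZero.recZeroCoe <;> induction y using WithZero.recZeroCoe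
  all_goals simp [← WithZero.coe_add]

open Classical in
/-- Countable sums in `WithZero K`: a sum is zero only if all its terms are. -/
noncomputable def withZeroCsum {ι : Type} [Countable ι] (f : ι → WithZero K) : WithZero K :=
  if ∀ i, f i = 0 then 0 else (csum fun i => unzero (f i) : K)

theorem withZeroCsum_eq_zero {ι : Type} [Countable ι] {f : ι → WithZero K} :
    withZeroCsum f = 0 ↔ ∀ i, f i = 0 := by
  unfold withZeroCsum
  split_ifs with h <;> simp [h]

theorem unzero_withZeroCsum {ι : Type} [Countable ι] (f : ι → WithZero K) :
    unzero (withZeroCsum f) = csum fun i => unzero (f i) := by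
  unfold withZeroCsum
  split_ifs with h
  · simp [h, csum_zero]
  · simp

noncomputable instance : CountablyCompleteSemiring (WithZero K) where
  __ : Semiring (WithZero K) := inferInstance
  mul_comm := mul_comm
  csum := withZeroCsum
  csum_empty f := withZeroCsum_eq_zero.2 isEmptyElim
  csum_unique f := withZero_ext (by rw [unzero_withZeroCsum, csum_unique])
    (by rw [withZeroCsum_eq_zero, Unique.forall_iff])
  csum_bool f := withZero_ext (by rw [unzero_withZeroCsum, csum_bool, map_add])
    (by rw [withZeroCsum_eq_zero, withZero_add_eq_zero, Bool.forall_bool, and_comm])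
  csum_partition g f := withZero_ext
    (by simp only [unzero_withZeroCsum]; exact csum_partition g _)
    (by
      simp only [withZeroCsum_eq_zero, Subtype.forall]
      exact ⟨fun h _ i _ => h i, fun h i => h _ i rfl⟩)
  mul_csum a f := withZero_ext (by simp only [unzero_withZeroCsum, map_mul, mul_csum])
    (by
      simp only [mul_eq_zero, withZeroCsum_eq_zero]
      by_cases h : a = 0 <;> simp [h])

theorem withZero_csum_eq_zero {ι : Type} [Countable ι] {f : ι → WithZero K} :
    csum f = 0 ↔ ∀ i, f i = 0 := withZeroCsum_eq_zero

theorem unzero_csum {ι : Type} [Countable ι] (f : ι → WithZero K) :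
    unzero (csum f) = csum fun i => unzero (f i) := unzero_withZeroCsum f

/-! ### Power series over a countably complete semiring -/

noncomputable instance : CountablyCompleteSemiring K⟦X⟧ where
  __ : CommSemiring K⟦X⟧ := inferInstance
  csum f := PowerSeries.mk fun n => csum fun i => coeff n (f i)
  csum_empty f := by ext; simp [csum_empty]
  csum_unique f := by ext; simp [csum_unique]
  csum_bool f := by ext; simp [csum_bool]
  csum_partition g f := by
    ext n
    simp only [coeff_mk]
    exact csum_partition g _
  mul_csum a f := by
    ext n
    simp only [coeff_mk, coeff_mul, csum_finset_sum, mul_csum]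

theorem coeff_csum {ι : Type} [Countable ι] (n : ℕ) (f : ι → K⟦X⟧) :
    coeff n (csum f) = csum fun i => coeff n (f i) := coeff_mk _ _

/-- Evaluation of a power series at `X = 1`, that is, the sum of its coefficients. -/
noncomputable def evalOne : K⟦X⟧ →+* K where
  toFun x := csum fun n => coeff n x
  map_zero' := by simpa using csum_zero
  map_one' := by
    rw [csum_eq_single 0 fun n hn => by rw [coeff_one, if_neg hn]]
    simp
  map_add' x y := by simp [csum_add]
  map_mul' x y := by
    have h : csum (fun n => coeff n x) * csum (fun n => coeff n y) =
        csum fun p : ℕ × ℕ => coeff p.1 x * coeff p.2 y := by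
      rw [csum_prod, csum_mul]
      simp only [mul_csum]
    rw [h, csum_partition fun p : ℕ × ℕ => p.1 + p.2]
    refine csum_congr fun n => ?_
    rw [coeff_mul, ← csum_equiv (Equiv.subtypeEquivRight
      fun p : ℕ × ℕ => Finset.HasAntidiagonal.mem_antidiagonal (n := n) (a := p)), csum_fintype]
    exact (Finset.sum_coe_sort (Finset.HasAntidiagonal.antidiagonal n)
      fun p : ℕ × ℕ => coeff p.1 x * coeff p.2 y).symm

theorem evalOne_apply (x : K⟦X⟧) : evalOne x = csum fun n => coeff n x := rfl

theorem evalOne_csum {ι : Type} [Countable ι] (f : ι → K⟦X⟧) :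
    evalOne (csum f) = csum fun i => evalOne (f i) := by
  simp only [evalOne_apply, coeff_csum]
  exact csum_comm _

theorem evalOne_C_mul_X (k : K) : evalOne (C k * X) = k := by
  rw [evalOne_apply, csum_eq_single 1 fun n hn => by rw [coeff_C_mul, coeff_X, if_neg hn, mul_zero]]
  simp

theorem evalOne_X : evalOne (X : K⟦X⟧) = 1 := by
  simpa using evalOne_C_mul_X (1 : K)

theorem evalOne_eq_zero {x : (WithZero K)⟦X⟧} : evalOne x = 0 ↔ x = 0 := by
  rw [evalOne_apply, withZero_csum_eq_zero, PowerSeries.ext_iff]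
  simp

end CountablyCompleteSemiring

/-! ### Agreement of power series up to a given order -/

namespace PowerSeries

variable {R : Type*} [CommSemiring R]

/-- The coefficients of `x` and `y` of degree less than `n` agree. -/
def EqUpTo (n : ℕ) (x y : R⟦X⟧) : Prop := ∀ m < n, coeff m x = coeff m y

namespace EqUpTo

variable {n : ℕ} {x y x' y' : R⟦X⟧}

theorem refl (n : ℕ) (x : R⟦X⟧) : EqUpTo n x x := fun _ _ => rfl

theorem add (h : EqUpTo n x y) (h' : EqUpTo n x' y') : EqUpTo n (x + x') (y + y') :=
  fun m hm => by rw [map_add, map_add, h m hm, h' m hm]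

theorem mul (h : EqUpTo n x y) (h' : EqUpTo n x' y') : EqUpTo n (x * x') (y * y') := by
  intro m hm
  rw [coeff_mul, coeff_mul]
  refine Finset.sum_congr rfl fun p hp => ?_
  have hp := Finset.HasAntidiagonal.mem_antidiagonal.1 hp
  rw [h _ (by omega), h' _ (by omega)]

theorem sum {ι : Type*} {s : Finset ι} {f g : ι → R⟦X⟧} (h : ∀ i ∈ s, EqUpTo n (f i) (g i)) :
    EqUpTo n (∑ i ∈ s, f i) (∑ i ∈ s, g i) := by
  intro m hm
  rw [map_sum, map_sum]
  exact Finset.sum_congr rfl fun i hi => h i hi m hm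

/-- Multiplication by a series without constant term is contracting. -/
theorem mul_succ {c : R⟦X⟧} (hc : constantCoeff c = 0) (h : EqUpTo n x y) :
    EqUpTo (n + 1) (c * x) (c * y) := by
  intro m hm
  rw [coeff_mul, coeff_mul]
  refine Finset.sum_congr rfl fun p hp => ?_
  have hp := Finset.HasAntidiagonal.mem_antidiagonal.1 hp
  rcases Nat.eq_zero_or_pos p.1 with h0 | h0
  · rw [h0, coeff_zero_eq_constantCoeff_apply, hc, zero_mul, zero_mul]
  · rw [h _ (by omega)]

end EqUpTo

theorem eq_of_forall_eqUpTo {x y : R⟦X⟧} (h : ∀ n, EqUpTo n x y) : x = y := by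
  ext n
  exact h (n + 1) n n.lt_succ_self

/-- A contracting system of equations for a family of power series has a solution. -/
theorem exists_fixedPoint {I : Type*} (Φ : (I → R⟦X⟧) → I → R⟦X⟧)
    (hΦ : ∀ n x y, (∀ i, EqUpTo n (x i) (y i)) → ∀ i, EqUpTo (n + 1) (Φ x i) (Φ y i)) :
    ∃ x, Φ x = x := by
  have hstep (n : ℕ) : ∀ i, EqUpTo n (Φ^[n] 0 i) (Φ^[n + 1] 0 i) := by
    induction n with
    | zero => exact fun i m hm => absurd hm m.not_lt_zero
    | succ n ih => rw [Function.iterate_succ_apply', Function.iterate_succ_apply']; exact hΦ n _ _ ih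
  have hstab (n k : ℕ) (i : I) : EqUpTo n (Φ^[n] 0 i) (Φ^[n + k] 0 i) := by
    induction k with
    | zero => exact EqUpTo.refl _ _
    | succ k ih => exact fun m hm => (ih m hm).trans (hstep (n + k) i m (by omega))
  -- The coefficient of degree `n` no longer changes after `n + 1` iterations.
  let x : I → R⟦X⟧ := fun i => PowerSeries.mk fun n => coeff n (Φ^[n + 1] 0 i)
  have hx (n : ℕ) (i : I) : EqUpTo n (x i) (Φ^[n] 0 i) := by
    intro m hm
    obtain ⟨k, rfl⟩ := Nat.exists_eq_add_of_lt hm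
    rw [coeff_mk, hstab (m + 1) k i m m.lt_succ_self, add_right_comm]
  refine ⟨x, funext fun i => eq_of_forall_eqUpTo fun n m hm => ?_⟩
  rw [hΦ n x _ (hx n) i m (by omega), hx (n + 1) i m (by omega), Function.iterate_succ_apply']

end PowerSeries

/-! ### Formal series over strings -/

/-- Formal power series in noncommuting variables: functions from strings to coefficients, with
the convolution product. -/
def StringSeries (T : Type) (L : Type*) : Type _ := List T → L

namespace StringSeries

variable {T : Type} {L : Type*}

@[ext] theorem ext {f g : StringSeries T L} (h : ∀ y, f y = g y) : f = g := funext h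

/-- The left quotient of `f` by the letter `a`. -/
def quot (a : T) (f : StringSeries T L) : StringSeries T L := fun y => f (a :: y)

@[simp] theorem quot_apply (a : T) (f : StringSeries T L) (y : List T) : quot a f y = f (a :: y) :=
  rfl

variable [CommSemiring L]

instance : AddCommMonoid (StringSeries T L) := inferInstanceAs (AddCommMonoid (List T → L))

instance : Module L (StringSeries T L) := inferInstanceAs (Module L (List T → L))

/-- The convolution product `y ↦ ∑ f u * g v` over all factorizations `y = u ++ v`. -/
def conv : StringSeries T L → StringSeries T L → List T → L
  | f, g, [] => f [] * g []
  | f, g, a :: y => f [] * g (a :: y) + conv (quot a f) g y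

instance : Mul (StringSeries T L) := ⟨fun f g => conv f g⟩

instance : One (StringSeries T L) := ⟨fun y => if y.isEmpty then 1 else 0⟩

@[simp] theorem zero_apply (y : List T) : (0 : StringSeries T L) y = 0 := rfl

@[simp] theorem add_apply (f g : StringSeries T L) (y : List T) : (f + g) y = f y + g y := rfl

@[simp] theorem smul_apply (c : L) (f : StringSeries T L) (y : List T) : (c • f) y = c * f y := rfl

@[simp] theorem one_nil : (1 : StringSeries T L) [] = 1 := rfl

@[simp] theorem one_cons (a : T) (y : List T) : (1 : StringSeries T L) (a :: y) = 0 := rfl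

@[simp] theorem mul_nil (f g : StringSeries T L) : (f * g) [] = f [] * g [] := rfl

theorem mul_cons (f g : StringSeries T L) (a : T) (y : List T) :
    (f * g) (a :: y) = f [] * g (a :: y) + (quot a f * g) y := rfl

theorem quot_add (a : T) (f g : StringSeries T L) : quot a (f + g) = quot a f + quot a g := rfl

theorem quot_smul (a : T) (c : L) (f : StringSeries T L) : quot a (c • f) = c • quot a f := rfl

theorem quot_mul (a : T) (f g : StringSeries T L) :
    quot a (f * g) = f [] • quot a g + quot a f * g := rfl

theorem quot_one (a : T) : quot a (1 : StringSeries T L) = 0 := rfl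

protected theorem zero_mul (f : StringSeries T L) : 0 * f = 0 := by
  ext y
  induction y with
  | nil => simp
  | cons a y ih =>
    rw [mul_cons, show quot a (0 : StringSeries T L) = 0 from rfl, ih]
    simp

protected theorem add_mul (f g h : StringSeries T L) : (f + g) * h = f * h + g * h := by
  ext y
  induction y generalizing f g with
  | nil => simp [_root_.add_mul]
  | cons a y ih =>
    simp only [mul_cons, quot_add, ih, add_apply]
    ring

protected theorem mul_add (f g h : StringSeries T L) : f * (g + h) = f * g + f * h := by
  ext y
  induction y generalizing f with
  | nil => simp [_root_.mul_add]
  | cons a y ih =>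
    simp only [mul_cons, ih, add_apply]
    ring

protected theorem smul_mul (c : L) (f g : StringSeries T L) : (c • f) * g = c • (f * g) := by
  ext y
  induction y generalizing f with
  | nil => simp [mul_assoc]
  | cons a y ih =>
    simp only [mul_cons, quot_smul, ih, smul_apply]
    ring

protected theorem mul_smul' (c : L) (f g : StringSeries T L) : f * (c • g) = c • (f * g) := by
  ext y
  induction y generalizing f with
  | nil => simp [mul_left_comm]
  | cons a y ih =>
    simp only [mul_cons, ih, smul_apply]
    ring

protected theorem mul_assoc (f g h : StringSeries T L) : f * g * h = f * (g * h) := by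
  ext y
  induction y generalizing f with
  | nil => simp [_root_.mul_assoc]
  | cons a y ih =>
    simp only [mul_cons, quot_mul, StringSeries.add_mul, StringSeries.smul_mul, ih, add_apply,
      smul_apply, mul_nil]
    ring

protected theorem one_mul (f : StringSeries T L) : 1 * f = f := by
  ext y
  cases y with
  | nil => simp
  | cons a y => simp [mul_cons, quot_one, StringSeries.zero_mul]

protected theorem mul_one (f : StringSeries T L) : f * 1 = f := by
  ext y
  induction y generalizing f with
  | nil => simp
  | cons a y ih => simp [mul_cons, ih]

instance : Semiring (StringSeries T L) where
  zero_mul := StringSeries.zero_mul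
  mul_zero f := by simpa using StringSeries.mul_smul' (0 : L) f 0
  left_distrib := StringSeries.mul_add
  right_distrib := StringSeries.add_mul
  mul_assoc := StringSeries.mul_assoc
  one_mul := StringSeries.one_mul
  mul_one := StringSeries.mul_one

instance : Algebra L (StringSeries T L) :=
  Algebra.ofModule StringSeries.smul_mul StringSeries.mul_smul'

@[simp] theorem sum_apply {ι : Type*} (s : Finset ι) (f : ι → StringSeries T L) (y : List T) :
    (∑ i ∈ s, f i) y = ∑ i ∈ s, f i y := Finset.sum_apply y s f

open Classical in
/-- The series of a one-letter string. -/
noncomputable def letter (a : T) : StringSeries T L := fun y => if y = [a] then 1 else 0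

@[simp] theorem letter_nil (a : T) : (letter a : StringSeries T L) [] = 0 := by simp [letter]

open Classical in
theorem letter_mul_cons (a b : T) (f : StringSeries T L) (y : List T) :
    (letter a * f : StringSeries T L) (b :: y) = if a = b then f y else 0 := by
  have h : quot b (letter a : StringSeries T L) = if a = b then 1 else 0 := by
    ext y
    split_ifs with h <;> cases y <;> simp [letter, h, Ne.symm]
  rw [mul_cons, h]
  split_ifs <;> simp

/-- The part of a series supported on nonempty strings. -/
def pos : StringSeries T L →ₗ[L] StringSeries T L where
  toFun f y := if y.isEmpty then 0 else f y
  map_add' f g := funext fun y => by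
    cases y with
    | nil => exact (add_zero 0).symm
    | cons a y => rfl
  map_smul' c f := funext fun y => by
    cases y with
    | nil => exact (mul_zero c).symm
    | cons a y => rfl

@[simp] theorem pos_nil (f : StringSeries T L) : pos f [] = 0 := rfl

@[simp] theorem pos_cons (f : StringSeries T L) (a : T) (y : List T) :
    pos f (a :: y) = f (a :: y) := rfl

theorem eq_smul_one_add_pos (f : StringSeries T L) : f = f [] • 1 + pos f := by
  ext y
  cases y <;> simp

theorem pos_eq_self {f : StringSeries T L} (h : f [] = 0) : pos f = f := by
  ext y
  cases y <;> simp [h]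

@[simp] theorem pos_one : pos (1 : StringSeries T L) = 0 := by
  ext y
  cases y <;> rfl

/-- The nonempty part of `u * f * v`: either `f` contributes a nonempty string, or it contributes
the empty string and `u * v` contributes a nonempty one. -/
theorem pos_mul_mul (u f v : StringSeries T L) :
    pos (u * f * v) = u * pos f * v + f [] • pos (u * v) := by
  conv_lhs => rw [eq_smul_one_add_pos f]
  rw [mul_add, add_mul, mul_smul_comm, mul_one, smul_mul_assoc, map_add, map_smul, add_comm,
    pos_eq_self (f := u * pos f * v) (by simp)]

section EqUpTo

variable {R : Type*} [CommSemiring R]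

/-- Agreement of all coefficients up to order `n`. -/
def EqUpTo (n : ℕ) (f g : StringSeries T R⟦X⟧) : Prop := ∀ y, PowerSeries.EqUpTo n (f y) (g y)

namespace EqUpTo

variable {n : ℕ} {f g f' g' : StringSeries T R⟦X⟧}

theorem of_eq (n : ℕ) (h : f = g) : EqUpTo n f g := fun _ _ _ => by rw [h]

theorem zero (f g : StringSeries T R⟦X⟧) : EqUpTo 0 f g := fun _ m hm => absurd hm m.not_lt_zero

theorem mul (h : EqUpTo n f g) (h' : EqUpTo n f' g') : EqUpTo n (f * f') (g * g') := by
  intro y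
  induction y generalizing f g with
  | nil => exact (h []).mul (h' [])
  | cons a y ih => exact ((h []).mul (h' _)).add (ih fun y => h (a :: y))

theorem sum {ι : Type*} {s : Finset ι} {F G : ι → StringSeries T R⟦X⟧}
    (h : ∀ i ∈ s, EqUpTo n (F i) (G i)) : EqUpTo n (∑ i ∈ s, F i) (∑ i ∈ s, G i) := by
  intro y
  rw [sum_apply, sum_apply]
  exact PowerSeries.EqUpTo.sum fun i hi => h i hi y

theorem smul_succ {c : R⟦X⟧} (hc : constantCoeff c = 0) (h : EqUpTo n f g) :
    EqUpTo (n + 1) (c • f) (c • g) :=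
  fun y => (h y).mul_succ hc

end EqUpTo

theorem eq_of_forall_eqUpTo {f g : StringSeries T R⟦X⟧} (h : ∀ n, EqUpTo n f g) : f = g :=
  ext fun y => PowerSeries.eq_of_forall_eqUpTo fun n => h n y

end EqUpTo

end StringSeries

/-! ### Derivation sums of a weighted linear indexed grammar -/

namespace Production

variable {N T Γ : Type}

open Classical in
/-- The form by which the production replaces `X[σ]`, if it is applicable to `X[σ]`. -/
noncomputable def rhs? : Production N T Γ → N → List Γ → Option (List (FormSymbol N T Γ))
  | .inherit X α l X' α' r, Y, σ =>
    if X = Y ∧ α <:+ σ then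
      some (l ++ FormSymbol.nonterm X' (σ.take (σ.length - α.length) ++ α') :: r)
    else none
  | .terminal X α a, Y, σ => if X = Y ∧ α = σ then some (a.toList.map FormSymbol.term) else none

theorem rewrites_iff {p : Production N T Γ} {X : N} {σ : List Γ} {γ : List (FormSymbol N T Γ)} :
    p.Rewrites X σ γ ↔ p.rhs? X σ = some γ := by
  constructor
  · rintro (⟨X, α, l, X', α', r, ρ⟩ | ⟨X, α, a⟩) <;> simp [rhs?]
  · cases p with
    | inherit Y α l X' α' r =>
      simp only [rhs?, Option.ite_none_right_eq_some, Option.some.injEq]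
      rintro ⟨⟨rfl, ρ, rfl⟩, rfl⟩
      simpa using Rewrites.inherit Y α l X' α' r ρ
    | terminal Y α a =>
      simp only [rhs?, Option.ite_none_right_eq_some, Option.some.injEq]
      rintro ⟨⟨rfl, rfl⟩, rfl⟩
      exact Rewrites.terminal Y α a

end Production

namespace WLIG

open CountablyCompleteSemiring

variable {T : Type} {K : Type*} {G : WLIG T K}

theorem leftmostDerives_nil_iff {d : List G.rules} {y : List T} :
    G.LeftmostDerives [] d y ↔ d = [] ∧ y = [] := by
  constructor
  · intro h
    generalize hβ : ([] : G.Form) = β at h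
    cases h with
    | nil => simpa [ofString, eq_comm] using hβ
    | cons => simp at hβ
  · rintro ⟨rfl, rfl⟩
    exact .nil []

theorem leftmostDerives_term_iff {a : T} {β : G.Form} {d : List G.rules} {y : List T} :
    G.LeftmostDerives (.term a :: β) d y ↔ ∃ y', y = a :: y' ∧ G.LeftmostDerives β d y' := by
  constructor
  · intro h
    generalize hβ : FormSymbol.term a :: β = β' at h
    induction h generalizing β with
    | nil y =>
      cases y with
      | nil => simp [ofString] at hβ
      | cons b y =>
        obtain ⟨h1, rfl⟩ := List.cons.inj hβ
        cases h1
        exact ⟨y, rfl, .nil y⟩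
    | cons p u Ψ' X σ γ d y h hd ih =>
      cases u with
      | nil => simp [ofString] at hβ
      | cons b u =>
        obtain ⟨h1, rfl⟩ := List.cons.inj hβ
        cases h1
        obtain ⟨y', rfl, hy'⟩ := ih (β := G.ofString u ++ γ ++ Ψ') rfl
        exact ⟨y', rfl, .cons p u Ψ' X σ γ d y' h hy'⟩
  · rintro ⟨y, rfl, h⟩
    cases h with
    | nil => exact .nil (a :: y)
    | cons p u Ψ' X σ γ d y h hd =>
      refine .cons p (a :: u) Ψ' X σ γ d (a :: y) h ?_
      change G.LeftmostDerives (FormSymbol.term a :: (G.ofString u ++ γ ++ Ψ')) d (a :: y)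
      generalize G.ofString u ++ γ ++ Ψ' = β at hd
      clear h
      induction hd with
      | nil y => exact .nil (a :: y)
      | cons p u Ψ' X σ γ d y h hd ih => exact .cons p (a :: u) Ψ' X σ γ d (a :: y) h ih

theorem leftmostDerives_nonterm_iff {X : G.N} {σ : List G.Γ} {β : G.Form} {d : List G.rules}
    {y : List T} :
    G.LeftmostDerives (.nonterm X σ :: β) d y ↔
      ∃ p d' γ, d = p :: d' ∧ p.1.rhs? X σ = some γ ∧ G.LeftmostDerives (γ ++ β) d' y := by
  constructor
  · intro h
    generalize hβ : FormSymbol.nonterm X σ :: β = β' at h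
    cases h with
    | nil => cases y <;> simp [ofString] at hβ
    | cons p u Ψ' X' σ' γ d y h hd =>
      cases u with
      | nil =>
        obtain ⟨h1, rfl⟩ := List.cons.inj hβ
        cases h1
        exact ⟨p, d, γ, rfl, Production.rewrites_iff.1 h, hd⟩
      | cons b u => simp [ofString] at hβ
  · rintro ⟨p, d, γ, rfl, h, hd⟩
    exact .cons p [] β X σ γ d y (Production.rewrites_iff.2 h) hd

theorem LeftmostDerives.reflTransGen {β : G.Form} {d : List G.rules} {y : List T}
    (h : G.LeftmostDerives β d y) : Relation.ReflTransGen G.Step β (G.ofString y) := by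
  induction h with
  | nil y => exact .refl
  | cons p u Ψ' X σ γ d y h hd ih => exact .head (.mk p _ Ψ' X σ γ h) ih

/-- A step at an arbitrary position can be put in front of a leftmost derivation. -/
theorem exists_leftmostDerives_of_step {p : G.rules} {Ψ Ψ' : G.Form} {X : G.N} {σ : List G.Γ}
    {γ : G.Form} (h : p.1.rhs? X σ = some γ) {d : List G.rules} {y : List T}
    (hd : G.LeftmostDerives (Ψ ++ γ ++ Ψ') d y) :
    ∃ d', G.LeftmostDerives (Ψ ++ .nonterm X σ :: Ψ') d' y := by
  induction d generalizing Ψ y with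
  | nil =>
    induction Ψ generalizing y with
    | nil => exact ⟨_, leftmostDerives_nonterm_iff.2 ⟨p, [], γ, rfl, h, hd⟩⟩
    | cons s Ψ ih =>
      cases s with
      | term a =>
        obtain ⟨y', rfl, hy'⟩ := leftmostDerives_term_iff.1 hd
        obtain ⟨d', hd'⟩ := ih hy'
        exact ⟨d', leftmostDerives_term_iff.2 ⟨y', rfl, hd'⟩⟩
      | nonterm Z τ =>
        obtain ⟨q, d', δ, h0, -⟩ := leftmostDerives_nonterm_iff.1 hd
        cases h0
  | cons q d ihd =>
    induction Ψ generalizing y with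
    | nil => exact ⟨_, leftmostDerives_nonterm_iff.2 ⟨p, q :: d, γ, rfl, h, hd⟩⟩
    | cons s Ψ ih =>
      cases s with
      | term a =>
        obtain ⟨y', rfl, hy'⟩ := leftmostDerives_term_iff.1 hd
        obtain ⟨d', hd'⟩ := ih hy'
        exact ⟨d', leftmostDerives_term_iff.2 ⟨y', rfl, hd'⟩⟩
      | nonterm Z τ =>
        obtain ⟨q', d', δ, h0, hδ, hd'⟩ := leftmostDerives_nonterm_iff.1 hd
        cases h0
        obtain ⟨d'', hd''⟩ := ihd (Ψ := δ ++ Ψ) (by simpa using hd')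
        exact ⟨q :: d'', leftmostDerives_nonterm_iff.2
          ⟨q, d'', δ, rfl, hδ, by simpa using hd''⟩⟩

theorem mem_language_iff {y : List T} :
    y ∈ G.language ↔ ∃ d, G.LeftmostDerives G.initForm d y := by
  constructor
  · intro h
    change Relation.ReflTransGen G.Step G.initForm (G.ofString y) at h
    generalize G.initForm = β at h ⊢
    induction h using Relation.ReflTransGen.head_induction_on with
    | refl => exact ⟨[], .nil y⟩
    | head hs _ ih =>
      obtain ⟨p, Ψ, Ψ', X, σ, γ, hr⟩ := hs
      obtain ⟨d, hd⟩ := ih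
      exact exists_leftmostDerives_of_step (Production.rewrites_iff.1 hr) hd
  · rintro ⟨d, hd⟩
    exact hd.reflTransGen

variable {L : Type*} [CountablyCompleteSemiring L]

/-- The series of total weights of the leftmost derivations from `β`. The production weights `w` may
lie in a semiring `L` other than that of `G`. -/
noncomputable def derivSum (G : WLIG T K) (w : G.rules → L) (β : G.Form) : StringSeries T L :=
  fun y => csum fun d : {d : List G.rules // G.LeftmostDerives β d y} => (d.1.map w).prod

variable (w : G.rules → L)

theorem derivSum_nil : G.derivSum w [] = 1 := by
  ext y
  cases y with
  | nil =>
    let _ : Unique {d : List G.rules // G.LeftmostDerives [] d []} :=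
      ⟨⟨⟨[], .nil []⟩⟩, fun d => Subtype.ext (leftmostDerives_nil_iff.1 d.2).1⟩
    exact csum_unique _
  | cons a y =>
    have : IsEmpty {d : List G.rules // G.LeftmostDerives [] d (a :: y)} :=
      ⟨fun d => by simpa using (leftmostDerives_nil_iff.1 d.2).2⟩
    exact csum_empty _

theorem derivSum_term (a : T) (β : G.Form) :
    G.derivSum w (.term a :: β) = StringSeries.letter a * G.derivSum w β := by
  ext y
  cases y with
  | nil =>
    have : IsEmpty {d : List G.rules // G.LeftmostDerives (.term a :: β) d []} :=
      ⟨fun d => by simpa using leftmostDerives_term_iff.1 d.2⟩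
    rw [StringSeries.mul_nil, StringSeries.letter_nil, zero_mul]
    exact csum_empty _
  | cons b y =>
    rw [StringSeries.letter_mul_cons]
    split_ifs with hab
    · subst hab
      have e (d : List G.rules) :
          G.LeftmostDerives (.term a :: β) d (a :: y) ↔ G.LeftmostDerives β d y := by
        simp [leftmostDerives_term_iff]
      exact csum_equiv (Equiv.subtypeEquivRight e) fun d => (d.1.map w).prod
    · have : IsEmpty {d : List G.rules // G.LeftmostDerives (.term a :: β) d (b :: y)} :=
        ⟨fun d => by
          obtain ⟨y', h, -⟩ := leftmostDerives_term_iff.1 d.2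
          exact hab (List.cons.inj h).1.symm⟩
      exact csum_empty _

/-- Leftmost derivations from `X[σ] β` are classified by their first production. -/
def nontermEquiv (X : G.N) (σ : List G.Γ) (β : G.Form) (y : List T) :
    (Σ p : G.rules, {d : List G.rules //
      ∃ γ, p.1.rhs? X σ = some γ ∧ G.LeftmostDerives (γ ++ β) d y}) ≃
    {d : List G.rules // G.LeftmostDerives (.nonterm X σ :: β) d y} where
  toFun x := ⟨x.1 :: x.2.1, by
    obtain ⟨p, d, γ, h, hd⟩ := x
    exact leftmostDerives_nonterm_iff.2 ⟨p, d, γ, rfl, h, hd⟩⟩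
  invFun
    | ⟨[], h⟩ => False.elim (by simpa using leftmostDerives_nonterm_iff.1 h)
    | ⟨p :: d, h⟩ => ⟨p, d, by
        obtain ⟨q, d', γ, h0, hγ, hd⟩ := leftmostDerives_nonterm_iff.1 h
        cases h0
        exact ⟨γ, hγ, hd⟩⟩
  left_inv x := rfl
  right_inv
    | ⟨[], h⟩ => False.elim (by simpa using leftmostDerives_nonterm_iff.1 h)
    | ⟨p :: d, h⟩ => rfl

theorem derivSum_nonterm (X : G.N) (σ : List G.Γ) (β : G.Form) :
    G.derivSum w (.nonterm X σ :: β) =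
      ∑ p : G.rules, w p • (p.1.rhs? X σ).elim 0 fun γ => G.derivSum w (γ ++ β) := by
  ext y
  rw [derivSum, ← csum_equiv (nontermEquiv X σ β y), csum_sigma, csum_fintype,
    StringSeries.sum_apply]
  refine Finset.sum_congr rfl fun p _ => ?_
  simp only [nontermEquiv, Equiv.coe_fn_mk, List.map_cons, List.prod_cons,
    StringSeries.smul_apply, ← mul_csum]
  congr 1
  cases p.1.rhs? X σ with
  | none =>
    have : IsEmpty {d : List G.rules //
        ∃ γ, none = some γ ∧ G.LeftmostDerives (γ ++ β) d y} :=
      ⟨fun ⟨_, _, h, _⟩ => by cases h⟩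
    exact csum_empty _
  | some γ =>
    have e (d : List G.rules) : (∃ γ', some γ = some γ' ∧ G.LeftmostDerives (γ' ++ β) d y) ↔
        G.LeftmostDerives (γ ++ β) d y := by simp
    exact csum_equiv (Equiv.subtypeEquivRight e) fun d => (d.1.map w).prod

/-- Homomorphisms of countably complete semirings act on derivation sums. -/
theorem map_derivSum {L' : Type*} [CountablyCompleteSemiring L'] (φ : L →+* L')
    (hφ : ∀ {ι : Type} [Countable ι] (f : ι → L), φ (csum f) = csum fun i => φ (f i))
    (β : G.Form) (y : List T) :
    φ (G.derivSum w β y) = G.derivSum (fun p => φ (w p)) β y := by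
  simp only [derivSum, hφ, map_list_prod, List.map_map]
  rfl

end WLIG

namespace Production

variable {N T Γ : Type}

theorem rhs?_inherit_nil (X : N) (A : Γ) (l r : List (FormSymbol N T Γ)) (X' Y : N)
    (α : List Γ) : (inherit X [A] l X' α r).rhs? Y [] = none := by
  simp [rhs?]

theorem rhs?_terminal_nil (X Y : N) (A : Γ) (a : Option T) :
    (terminal (Γ := Γ) X [A] a).rhs? Y [] = none := by
  simp [rhs?]

open Classical in
theorem rhs?_inherit_concat (X : N) (A : Γ) (l r : List (FormSymbol N T Γ)) (X' Y : N)
    (α ρ : List Γ) (B : Γ) :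
    (inherit X [A] l X' α r).rhs? Y (ρ ++ [B]) =
      if X = Y ∧ A = B then some (l ++ FormSymbol.nonterm X' (ρ ++ α) :: r) else none := by
  have h : [A] <:+ ρ ++ [B] ↔ A = B :=
    ⟨fun ⟨τ, h⟩ => by simpa using (List.append_inj' h rfl).2, fun h => ⟨ρ, by rw [h]⟩⟩
  simp [rhs?, h]

open Classical in
theorem rhs?_terminal_concat (X Y : N) (A B : Γ) (ρ : List Γ) (a : Option T) :
    (terminal (Γ := Γ) X [A] a).rhs? Y (ρ ++ [B]) =
      if X = Y ∧ A = B ∧ ρ = [] then some (a.toList.map FormSymbol.term) else none := by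
  have h : [A] = ρ ++ [B] ↔ A = B ∧ ρ = [] := by
    refine ⟨fun h => ?_, fun ⟨h, h'⟩ => by rw [h, h', List.nil_append]⟩
    obtain ⟨h₁, h₂⟩ := List.append_inj' (s₁ := []) h rfl
    exact ⟨List.singleton_inj.1 h₂, h₁.symm⟩
  simp [rhs?, h]

end Production

namespace WLIG

open CountablyCompleteSemiring

variable {T : Type} {K : Type*} {G : WLIG T K} {R : Type*} [CountablyCompleteSemiring R]
  {w : G.rules → R⟦X⟧}

/-! ### The equations for derivation sums and their unique solution -/

/-- Derivation sums are multiplicative. The recursion over productions determines them, because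
each production contributes a factor without constant term. -/
theorem derivSum_append (hw : ∀ p, constantCoeff (w p) = 0) (β₁ β₂ : G.Form) :
    G.derivSum w (β₁ ++ β₂) = G.derivSum w β₁ * G.derivSum w β₂ := by
  refine StringSeries.eq_of_forall_eqUpTo fun n => ?_
  induction n generalizing β₁ β₂ with
  | zero => exact .zero _ _
  | succ n ihn =>
    induction β₁ with
    | nil => exact .of_eq _ (by rw [derivSum_nil, one_mul, List.nil_append])
    | cons s β ih =>
      cases s with
      | term a =>
        rw [List.cons_append, derivSum_term, derivSum_term, mul_assoc]
        exact (StringSeries.EqUpTo.of_eq _ rfl).mul ih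
      | nonterm X σ =>
        rw [List.cons_append, derivSum_nonterm, derivSum_nonterm, Finset.sum_mul]
        refine .sum fun p _ => ?_
        rw [smul_mul_assoc]
        refine .smul_succ (hw p) ?_
        cases p.1.rhs? X σ with
        | none => exact .of_eq _ (by simp)
        | some γ => simpa using ihn (γ ++ β) β₂

theorem derivSum_nonterm' (X : G.N) (σ : List G.Γ) :
    G.derivSum w [.nonterm X σ] =
      ∑ p : G.rules, w p • (p.1.rhs? X σ).elim 0 (G.derivSum w) := by
  simp only [derivSum_nonterm, List.append_nil]

/-- The product of the values of the symbols of a form, where terminals have their canonical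
value and `v` prescribes the values of the nonterminals with stacks. -/
noncomputable def formVal {N Γ : Type} {L : Type*} [CommSemiring L]
    (v : N → List Γ → StringSeries T L) (β : List (FormSymbol N T Γ)) : StringSeries T L :=
  (β.map fun
    | .term a => StringSeries.letter a
    | .nonterm X σ => v X σ).prod

section formVal

variable {N Γ : Type} {L : Type*} [CommSemiring L] (v : N → List Γ → StringSeries T L)

@[simp] theorem formVal_nil : formVal v [] = 1 := rfl

@[simp] theorem formVal_term (a : T) (β : List (FormSymbol N T Γ)) :
    formVal v (.term a :: β) = StringSeries.letter a * formVal v β := by simp [formVal]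

@[simp] theorem formVal_nonterm (X : N) (σ : List Γ) (β : List (FormSymbol N T Γ)) :
    formVal v (.nonterm X σ :: β) = v X σ * formVal v β := by simp [formVal]

@[simp] theorem formVal_append (β₁ β₂ : List (FormSymbol N T Γ)) :
    formVal v (β₁ ++ β₂) = formVal v β₁ * formVal v β₂ := by simp [formVal]

end formVal

/-- The system of equations given by the productions has a unique solution, on any set of
nonterminals with stacks that is closed under the productions. -/
theorem derivSum_eq_formVal (hw : ∀ p, constantCoeff (w p) = 0) (D : G.N → List G.Γ → Prop)
    (hD : ∀ p ∈ G.rules, ∀ X σ γ, D X σ → p.rhs? X σ = some γ →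
      ∀ Y τ, FormSymbol.nonterm Y τ ∈ γ → D Y τ)
    (v : G.N → List G.Γ → StringSeries T R⟦X⟧)
    (hv : ∀ X σ, D X σ → v X σ = ∑ p : G.rules, w p • (p.1.rhs? X σ).elim 0 (formVal v))
    (β : G.Form) (hβ : ∀ Y τ, FormSymbol.nonterm Y τ ∈ β → D Y τ) :
    G.derivSum w β = formVal v β := by
  refine StringSeries.eq_of_forall_eqUpTo fun n => ?_
  induction n generalizing β with
  | zero => exact .zero _ _
  | succ n ihn =>
    induction β with
    | nil => exact .of_eq _ (by rw [derivSum_nil, formVal_nil])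
    | cons s β ih =>
      have hβ' : ∀ Y τ, FormSymbol.nonterm Y τ ∈ β → D Y τ :=
        fun Y τ h => hβ Y τ (List.mem_cons_of_mem _ h)
      cases s with
      | term a =>
        rw [derivSum_term, formVal_term]
        exact (StringSeries.EqUpTo.of_eq _ rfl).mul (ih hβ')
      | nonterm X σ =>
        have hX : D X σ := hβ X σ List.mem_cons_self
        rw [derivSum_nonterm, formVal_nonterm, hv X σ hX, Finset.sum_mul]
        refine .sum fun p _ => ?_
        rw [smul_mul_assoc]
        refine .smul_succ (hw p) ?_
        rcases hp : p.1.rhs? X σ with _ | γ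
        · exact .of_eq _ (by simp)
        · rw [Option.elim_some, Option.elim_some, ← formVal_append]
          refine ihn _ fun Y τ h => ?_
          rcases List.mem_append.1 h with h | h
          · exact hD p.1 p.2 X σ γ hX hp Y τ h
          · exact hβ' Y τ h

/-- When all weights are nonzero in `WithZero K`, the language is the support of the stringsum. -/
theorem mem_language_iff_derivSum_ne_zero {K' : Type*} [CountablyCompleteSemiring K']
    {w : G.rules → (WithZero K')⟦X⟧} (hw : ∀ p, w p ≠ 0) {y : List T} :
    y ∈ G.language ↔ G.derivSum w G.initForm y ≠ 0 := by
  rw [← not_iff_not, not_not, mem_language_iff, ← evalOne_eq_zero,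
    map_derivSum w evalOne evalOne_csum, derivSum, withZero_csum_eq_zero]
  simp only [not_exists, Subtype.forall, List.prod_eq_zero_iff, List.mem_map, evalOne_eq_zero, hw,
    and_false, exists_false, imp_false]

/-! ### Weights of derivations of the empty string -/

variable (w) in
/-- The total weight of the derivations of the empty string from a form. -/
noncomputable def nullWeight (β : G.Form) : R⟦X⟧ := G.derivSum w β []

theorem nullWeight_append (hw : ∀ p, constantCoeff (w p) = 0) (β₁ β₂ : G.Form) :
    nullWeight w (β₁ ++ β₂) = nullWeight w β₁ * nullWeight w β₂ := by
  rw [nullWeight, derivSum_append hw]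
  rfl

theorem nullWeight_nonterm (X : G.N) (σ : List G.Γ) :
    nullWeight w [.nonterm X σ] =
      ∑ p : G.rules, w p * (p.1.rhs? X σ).elim 0 (nullWeight w) := by
  rw [nullWeight, derivSum_nonterm', StringSeries.sum_apply]
  refine Finset.sum_congr rfl fun p _ => ?_
  rw [StringSeries.smul_apply]
  cases p.1.rhs? X σ <;> rfl

theorem constantCoeff_nullWeight_nonterm (hw : ∀ p, constantCoeff (w p) = 0) (X : G.N)
    (σ : List G.Γ) : constantCoeff (nullWeight w [.nonterm X σ]) = 0 := by
  rw [nullWeight_nonterm, map_sum]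
  exact Finset.sum_eq_zero fun p _ => by rw [map_mul, hw, zero_mul]

open Classical in
variable (w) in
/-- The contribution of a production to the pop weights, given the pop weights `P` of the
configurations that it leads to. -/
noncomputable def popStep (P : G.N → List G.Γ → G.N → R⟦X⟧) :
    Production G.N T G.Γ → G.N → List G.Γ → G.N → R⟦X⟧
  | .inherit X α l X' α' r, Y, σ, Z =>
    if X = Y ∧ α <:+ σ then
      nullWeight w l * nullWeight w r * P X' (σ.take (σ.length - α.length) ++ α') Z
    else 0
  | .terminal _ _ _, _, _, _ => 0

theorem popStep_inherit_concat (P : G.N → List G.Γ → G.N → R⟦X⟧) (X : G.N) (A : G.Γ) (l r : G.Form)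
    (X' Y Z : G.N) (α ρ : List G.Γ) (B : G.Γ) [Decidable (X = Y ∧ A = B)] :
    popStep w P (.inherit X [A] l X' α r) Y (ρ ++ [B]) Z =
      if X = Y ∧ A = B then nullWeight w l * nullWeight w r * P X' (ρ ++ α) Z else 0 := by
  have h : [A] <:+ ρ ++ [B] ↔ A = B :=
    ⟨fun ⟨τ, h⟩ => by simpa using (List.append_inj' h rfl).2, fun h => ⟨ρ, by rw [h]⟩⟩
  simp [popStep, h]

variable (w) in
open Classical in
/-- `P X σ Z` is the total weight of the ways in which `X[ρ σ]` turns into `Z[ρ]` along the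
spine, popping `σ` without looking at `ρ`, while everything beside the spine derives the empty
string. This is encoded by the recursion over the first production. -/
structure IsPopWeight (P : G.N → List G.Γ → G.N → R⟦X⟧) : Prop where
  nil : ∀ X Z, P X [] Z = if X = Z then 1 else 0
  concat : ∀ X ρ A Z, P X (ρ ++ [A]) Z = ∑ p : G.rules, w p * popStep w P p.1 X (ρ ++ [A]) Z

theorem exists_isPopWeight (hw : ∀ p, constantCoeff (w p) = 0) : ∃ P, IsPopWeight w P := by
  classical
  let Φ (x : G.N × List G.Γ × G.N → R⟦X⟧) (i : G.N × List G.Γ × G.N) : R⟦X⟧ :=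
    if i.2.1 = [] then if i.1 = i.2.2 then 1 else 0
    else ∑ p : G.rules, w p * popStep w (fun X σ Z => x (X, σ, Z)) p.1 i.1 i.2.1 i.2.2
  obtain ⟨x, hx⟩ := PowerSeries.exists_fixedPoint Φ fun n x y h i => by
    simp only [Φ]
    split_ifs
    · exact .refl _ _
    · exact .refl _ _
    · refine .sum fun p _ => .mul_succ (hw p) ?_
      cases p.1 with
      | terminal => exact .refl _ _
      | inherit X α l X' α' r =>
        simp only [popStep]
        split_ifs
        · exact (PowerSeries.EqUpTo.refl _ _).mul (h _)
        · exact .refl _ _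
  refine ⟨fun X σ Z => x (X, σ, Z), fun X Z => ?_, fun X ρ A Z => ?_⟩
  · rw [← hx]
    simp [Φ]
  · conv_lhs => rw [← hx]
    simp [Φ]

theorem IsPopWeight.constantCoeff_eq_zero {P : G.N → List G.Γ → G.N → R⟦X⟧}
    (hP : IsPopWeight w P) (hw : ∀ p, constantCoeff (w p) = 0) (X Z : G.N) (A : G.Γ) :
    constantCoeff (P X [A] Z) = 0 := by
  rw [← List.nil_append [A], hP.concat, map_sum]
  exact Finset.sum_eq_zero fun p _ => by rw [map_mul, hw, zero_mul]

/-- The productions have the shape allowed in a top-down grammar with bottom symbol `S₀`. -/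
def HasTopDownRules (G : WLIG T K) (S₀ : G.Γ) : Prop :=
  ∀ p ∈ G.rules,
    (∃ X A l X' α r, p = .inherit X [A] l X' α r ∧
      ∀ Y σ, FormSymbol.nonterm Y σ ∈ l ++ r → σ = [S₀]) ∨
    (∃ X A a, p = .terminal X [A] a)

/-- A derivation of the empty string from `X[ρ σ]` has to pop `σ` before it can touch `ρ`. -/
theorem IsPopWeight.nullWeight_append_stack [Fintype G.N] {P : G.N → List G.Γ → G.N → R⟦X⟧}
    (hP : IsPopWeight w P) (hw : ∀ p, constantCoeff (w p) = 0) {S₀ : G.Γ}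
    (hG : G.HasTopDownRules S₀) {ρ : List G.Γ} (hρ : ρ ≠ []) (X : G.N) (σ : List G.Γ) :
    nullWeight w [.nonterm X (ρ ++ σ)] = ∑ Z, P X σ Z * nullWeight w [.nonterm Z ρ] := by
  classical
  refine PowerSeries.eq_of_forall_eqUpTo fun n => ?_
  induction n generalizing X σ with
  | zero => exact fun m hm => absurd hm m.not_lt_zero
  | succ n ih =>
    rcases List.eq_nil_or_concat' σ with rfl | ⟨σ, A, rfl⟩
    · -- Nothing has to be popped.
      simpa [hP.nil] using PowerSeries.EqUpTo.refl _ _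
    · rw [← List.append_assoc, nullWeight_nonterm]
      simp only [hP.concat, Finset.sum_mul]
      rw [Finset.sum_comm]
      refine .sum fun p _ => ?_
      simp only [mul_assoc, ← Finset.mul_sum]
      refine .mul_succ (hw p) ?_
      rcases hG p.1 p.2 with ⟨X₁, A₁, l, X', α, r, hp, -⟩ | ⟨X₁, A₁, a, hp⟩
      · simp only [hp, Production.rhs?_inherit_concat, popStep_inherit_concat]
        split_ifs with h
        · have h' := (PowerSeries.EqUpTo.refl n (nullWeight w l * nullWeight w r)).mul
            (ih X' (σ ++ α))
          rw [Finset.mul_sum] at h'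
          rw [Option.elim_some, nullWeight_append hw, ← List.singleton_append,
            nullWeight_append hw, mul_comm (nullWeight w [_]), ← mul_assoc]
          simpa [mul_assoc] using h'
        · simpa using PowerSeries.EqUpTo.refl n (0 : R⟦X⟧)
      · -- A production `X[A] → a` does not apply, as `ρ` lies below the top symbol.
        simp only [hp, Production.rhs?_terminal_concat]
        simpa [hρ, popStep] using PowerSeries.EqUpTo.refl n (0 : R⟦X⟧)

end WLIG

/-! ### The grammar without nullary productions -/

namespace WLIG

open CountablyCompleteSemiring

/-- The nonterminals of the grammar without nullary productions: a new start symbol; `keep X`,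
which derives the nonempty strings that `X` derives; and `drain X s`, which plays the part of an
`X` that derives the empty string, and then of the symbol `s` that had been standing next to it. -/
inductive TrimNonterm (N T : Type) where
  | newStart
  | keep (X : N)
  | drain (X : N) (s : N ⊕ T)

open TrimNonterm

instance {N T : Type} [Finite N] [Finite T] : Finite (TrimNonterm N T) := by
  refine Finite.of_surjective
    (fun x : Option (N ⊕ N × (N ⊕ T)) => match x with
      | none => newStart
      | some (.inl X) => keep X
      | some (.inr (X, s)) => drain X s) ?_
  rintro (_ | X | ⟨X, s⟩)
  · exact ⟨none, rfl⟩
  · exact ⟨some (.inl X), rfl⟩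
  · exact ⟨some (.inr (X, s)), rfl⟩

/-- The stack `σ` with the mark `b` at its bottom symbol and the mark `false` elsewhere. -/
def markBot {Γ : Type} (b : Bool) : List Γ → List (Γ × Bool)
  | [] => []
  | A :: σ => (A, b) :: σ.map fun B => (B, false)

theorem map_fst_markBot {Γ : Type} (b : Bool) (σ : List Γ) : (markBot b σ).map Prod.fst = σ := by
  cases σ <;> simp [markBot, Function.comp_def]

theorem markBot_concat {Γ : Type} (ρ : List Γ) (A : Γ) :
    markBot true (ρ ++ [A]) = markBot true ρ ++ [(A, ρ.isEmpty)] := by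
  cases ρ <;> simp [markBot]

/-- Rewriting the top symbol of a marked stack gives a marked stack, if the mark of that symbol is
passed on to the bottom of its replacement. -/
theorem markBot_append {Γ : Type} (ρ α : List Γ) :
    markBot true ρ ++ markBot ρ.isEmpty α = markBot true (ρ ++ α) := by
  cases ρ <;> cases α <;> simp [markBot]

variable {T : Type} {K : Type*} {G : WLIG T K} {R : Type*} [CountablyCompleteSemiring R]
  (w : G.rules → R⟦X⟧) (S₀ : G.Γ) (P : G.N → List G.Γ → G.N → R⟦X⟧)

/-- The series of nonempty strings derived from `Y[S₀]` or from a terminal. -/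
noncomputable def symVal : G.N ⊕ T → StringSeries T R⟦X⟧
  | .inl Y => StringSeries.pos (G.derivSum w [.nonterm Y [S₀]])
  | .inr a => StringSeries.letter a

theorem symVal_nil (s : G.N ⊕ T) : symVal w S₀ s [] = 0 := by
  cases s <;> simp [symVal]

/-- The ways of deleting nonterminals, assumed to derive the empty string, from a form. -/
noncomputable def expand : G.Form → (List (G.N ⊕ T) →₀ R⟦X⟧)
  | [] => Finsupp.single [] 1
  | .term a :: β => Finsupp.mapDomain (Sum.inr a :: ·) (expand β)
  | .nonterm Y σ :: β =>
    nullWeight w [.nonterm Y σ] • expand β + Finsupp.mapDomain (Sum.inl Y :: ·) (expand β)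

variable {w} in
theorem linearCombination_expand (hw : ∀ p, constantCoeff (w p) = 0) (β : G.Form)
    (hβ : ∀ Y σ, FormSymbol.nonterm Y σ ∈ β → σ = [S₀]) :
    Finsupp.linearCombination R⟦X⟧ (fun e => (e.map (symVal w S₀)).prod) (expand w β) =
      G.derivSum w β := by
  have hcons (s : G.N ⊕ T) (x : List (G.N ⊕ T) →₀ R⟦X⟧) :
      Finsupp.linearCombination R⟦X⟧ (fun e => (e.map (symVal w S₀)).prod)
          (Finsupp.mapDomain (s :: ·) x) =
        symVal w S₀ s *
          Finsupp.linearCombination R⟦X⟧ (fun e => (e.map (symVal w S₀)).prod) x := by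
    rw [Finsupp.linearCombination_mapDomain, Finsupp.linearCombination_apply,
      Finsupp.linearCombination_apply, Finsupp.mul_sum]
    simp
  induction β with
  | nil => simp [expand, derivSum_nil]
  | cons s β ih =>
    have ih := ih fun Y σ h => hβ Y σ (List.mem_cons_of_mem _ h)
    cases s with
    | term a => rw [expand, hcons, ih, derivSum_term, symVal]
    | nonterm Y σ =>
      obtain rfl := hβ Y σ List.mem_cons_self
      rw [expand, map_add, map_smul, hcons, ih, symVal, nullWeight, ← smul_one_mul, ← add_mul,
        ← StringSeries.eq_smul_one_add_pos, ← derivSum_append hw, List.singleton_append]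

/-- The occurrence of a symbol beside the spine of a production. -/
def toSym (s : G.N ⊕ T) : FormSymbol (TrimNonterm G.N T) T (G.Γ × Bool) :=
  s.elim (fun Y => .nonterm (keep Y) [(S₀, true)]) .term

/-- Productions of the grammar without nullary productions. -/
abbrev TrimProduction (G : WLIG T K) : Type := Production (TrimNonterm G.N T) T (G.Γ × Bool)

/-- The productions obtained from `X[.. A] → l X'[.. α] r` of weight `c` when the spine child
derives a nonempty string, with a mark `b` on `A`. -/
noncomputable def keepRules (c : R⟦X⟧) (X : G.N) (A : G.Γ) (l : G.Form) (X' : G.N) (α : List G.Γ)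
    (r : G.Form) (b : Bool) : TrimProduction G →₀ R⟦X⟧ :=
  (expand w l).sum fun e₁ c₁ => (expand w r).sum fun e₂ c₂ =>
    Finsupp.single (.inherit (keep X) [(A, b)] (e₁.map (toSym S₀)) (keep X') (markBot b α)
      (e₂.map (toSym S₀))) (c * (c₁ * c₂))

/-- The production of weight `c` by which `X`, with top symbol `A` marked `b`, pushes `α` and yields
the symbols `e`: the first symbol of `e` takes over the spine, once the stack has been emptied by
the derivations of the empty string from `X'`. -/
noncomputable def drainRule (X : G.N) (A : G.Γ) (X' : G.N) (α : List G.Γ) (b : Bool) (c : R⟦X⟧) :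
    List (G.N ⊕ T) → (TrimProduction G →₀ R⟦X⟧)
  | [] => 0
  | s :: e => Finsupp.single (.inherit (keep X) [(A, b)] [] (drain X' s) (markBot b α)
      (e.map (toSym S₀))) c

/-- The productions obtained from `X[.. A] → l X'[.. α] r` of weight `c` when the spine child
derives the empty string, with a mark `b` on `A`. Something beside the spine must then remain. -/
noncomputable def drainRules (c : R⟦X⟧) (X : G.N) (A : G.Γ) (l : G.Form) (X' : G.N)
    (α : List G.Γ) (r : G.Form) (b : Bool) : TrimProduction G →₀ R⟦X⟧ :=
  (expand w (l ++ r)).sum fun e c' => drainRule S₀ X A X' α b (c * c') e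

/-- The productions obtained from a production of weight `c`. -/
noncomputable def trimRule (c : R⟦X⟧) : Production G.N T G.Γ → (TrimProduction G →₀ R⟦X⟧)
  | .inherit X [A] l X' α r =>
    -- The top symbol may or may not be the bottom symbol of the stack.
    ∑ b : Bool, (keepRules w S₀ c X A l X' α r b + drainRules w S₀ c X A l X' α r b)
  | .terminal X [A] (some a) => Finsupp.single (.terminal (keep X) [(A, true)] (some a)) c
  | _ => 0

/-- The production by which `drain X s` leaves the bottom of the stack. -/
noncomputable def leaveRule (X : G.N) (A : G.Γ) : G.N ⊕ T → (TrimProduction G →₀ R⟦X⟧)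
  | .inl Y => Finsupp.single
      (.inherit (drain X (.inl Y)) [(A, true)] [] (keep Y) [(S₀, true)] [])
      (nullWeight w [.nonterm X [A]])
  | .inr a => Finsupp.single (.terminal (drain X (.inr a)) [(A, true)] (some a))
      (nullWeight w [.nonterm X [A]])

/-- The production by which `drain X s` pops a symbol above the bottom of the stack. -/
noncomputable def popRule (X : G.N) (s : G.N ⊕ T) (A : G.Γ) (Z : G.N) :
    TrimProduction G →₀ R⟦X⟧ :=
  Finsupp.single (.inherit (drain X s) [(A, false)] [] (drain Z s) [] []) (P X [A] Z)

/-- The productions of the new start symbol. -/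
noncomputable def startRules : TrimProduction G →₀ R⟦X⟧ :=
  Finsupp.single (.inherit newStart [(S₀, true)] [] (keep G.start) [(S₀, true)] []) X +
    Finsupp.single (.terminal newStart [(S₀, true)] none) (nullWeight w [.nonterm G.start [S₀]])

variable [Fintype G.N] [Fintype G.Γ] [Fintype T]

/-- The weights of all productions of the new grammar; the productions of nonzero weight are those
that are needed. -/
noncomputable def trimRules : TrimProduction G →₀ R⟦X⟧ :=
  startRules w S₀ + ∑ p : G.rules, trimRule w S₀ (w p) p.1 +
    ∑ X : G.N, ∑ A : G.Γ, ∑ s : G.N ⊕ T, (leaveRule w S₀ X A s + ∑ Z, popRule P X s A Z)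

/-- The shape of the productions of the new grammar: it is top-down with bottom symbol
`(S₀, true)`, passes marks on correctly, has the start symbol on no right-hand side, and has no
nullary production except for the start symbol. -/
def IsTrimRule : TrimProduction G → Prop
  | .inherit _ τ l X' τ' r => X' ≠ newStart ∧ (∃ A b α, τ = [(A, b)] ∧ τ' = markBot b α) ∧
      ∀ Y σ, FormSymbol.nonterm Y σ ∈ l ++ r → Y ≠ newStart ∧ σ = [(S₀, true)]
  | .terminal X τ a => (∃ B, τ = [B]) ∧ (a = none → X = newStart ∧ τ = [(S₀, true)])

/-- Weight functions supported on productions of the right shape, with weights without constant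
term. -/
def trimSubmonoid : AddSubmonoid (TrimProduction G →₀ R⟦X⟧) where
  carrier := {W | ∀ p, (W p ≠ 0 → IsTrimRule S₀ p) ∧ constantCoeff (W p) = 0}
  zero_mem' p := by simp
  add_mem' {V W} hV hW p := by
    refine ⟨fun h => ?_, by rw [Finsupp.add_apply, map_add, (hV p).2, (hW p).2, add_zero]⟩
    by_cases hp : V p = 0
    · exact (hW p).1 fun h' => h (by rw [Finsupp.add_apply, hp, h', add_zero])
    · exact (hV p).1 hp

omit [Fintype G.N] [Fintype G.Γ] [Fintype T] in
theorem single_mem_trimSubmonoid {q : TrimProduction G} (hq : IsTrimRule S₀ q) {c : R⟦X⟧}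
    (hc : constantCoeff c = 0) : Finsupp.single q c ∈ trimSubmonoid (R := R) S₀ := by
  intro p
  by_cases h : q = p
  · subst h
    simp [hq, hc]
  · simp [Finsupp.single_eq_of_ne' h]

omit [Fintype G.N] [Fintype G.Γ] [Fintype T] in
theorem single_inherit_mem {X X' : TrimNonterm G.N T} {τ τ' : List (G.Γ × Bool)}
    {l r : List (FormSymbol (TrimNonterm G.N T) T (G.Γ × Bool))} {c : R⟦X⟧} (hX' : X' ≠ newStart)
    (hτ : ∃ A b α, τ = [(A, b)] ∧ τ' = markBot b α)
    (hside : ∀ Y σ, FormSymbol.nonterm Y σ ∈ l ++ r → Y ≠ newStart ∧ σ = [(S₀, true)])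
    (hc : constantCoeff c = 0) :
    Finsupp.single (.inherit X τ l X' τ' r) c ∈ trimSubmonoid (R := R) S₀ :=
  single_mem_trimSubmonoid S₀ (q := .inherit X τ l X' τ' r) ⟨hX', hτ, hside⟩ hc

omit [Fintype G.N] [Fintype G.Γ] [Fintype T] in
theorem single_terminal_mem {X : TrimNonterm G.N T} {τ : List (G.Γ × Bool)} {a : Option T}
    {c : R⟦X⟧} (hτ : ∃ B, τ = [B]) (ha : a = none → X = newStart ∧ τ = [(S₀, true)])
    (hc : constantCoeff c = 0) :
    Finsupp.single (.terminal X τ a) c ∈ trimSubmonoid (R := R) S₀ :=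
  single_mem_trimSubmonoid S₀ (q := .terminal X τ a) ⟨hτ, ha⟩ hc

omit [Fintype G.N] [Fintype G.Γ] [Fintype T] in
theorem of_mem_map_toSym {e : List (G.N ⊕ T)} {Y : TrimNonterm G.N T} {σ : List (G.Γ × Bool)}
    (h : FormSymbol.nonterm Y σ ∈ e.map (toSym S₀)) : Y ≠ newStart ∧ σ = [(S₀, true)] := by
  obtain ⟨s, -, hs⟩ := List.mem_map.1 h
  cases s <;> cases hs
  exact ⟨nofun, rfl⟩

variable {w S₀ P}

theorem trimRules_mem (hw : ∀ p, constantCoeff (w p) = 0) (hP : IsPopWeight w P) :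
    trimRules w S₀ P ∈ trimSubmonoid (R := R) S₀ := by
  have hnull := constantCoeff_nullWeight_nonterm hw
  have hside (Y : TrimNonterm G.N T) (σ : List (G.Γ × Bool)) :
      FormSymbol.nonterm Y σ ∈ ([] : List (FormSymbol (TrimNonterm G.N T) T (G.Γ × Bool))) ++ [] →
        Y ≠ newStart ∧ σ = [(S₀, true)] := nofun
  refine add_mem (add_mem (add_mem ?_ ?_) (sum_mem fun p _ => ?_))
    (sum_mem fun X _ => sum_mem fun A _ => sum_mem fun s _ => add_mem ?_ (sum_mem fun Z _ => ?_))
  · exact single_inherit_mem S₀ nofun ⟨S₀, true, [S₀], rfl, rfl⟩ hside constantCoeff_X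
  · exact single_terminal_mem S₀ ⟨_, rfl⟩ (fun _ => ⟨rfl, rfl⟩) (hnull _ _)
  · have hp := hw p
    unfold trimRule
    split
    · refine sum_mem fun b _ => add_mem (sum_mem fun e₁ _ => sum_mem fun e₂ _ => ?_)
        (sum_mem fun e _ => ?_)
      · refine single_inherit_mem S₀ nofun ⟨_, b, _, rfl, rfl⟩ (fun Y σ h => ?_)
          (by rw [map_mul, hp, zero_mul])
        rw [← List.map_append] at h
        exact of_mem_map_toSym S₀ h
      · cases e with
        | nil => exact zero_mem _
        | cons s e =>
          exact single_inherit_mem S₀ nofun ⟨_, b, _, rfl, rfl⟩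
            (fun Y σ h => of_mem_map_toSym S₀ h) (by rw [map_mul, hp, zero_mul])
    · exact single_terminal_mem S₀ ⟨_, rfl⟩ nofun hp
    · exact zero_mem _
  · cases s with
    | inl Y => exact single_inherit_mem S₀ nofun ⟨A, true, [S₀], rfl, rfl⟩ hside (hnull _ _)
    | inr a => exact single_terminal_mem S₀ ⟨_, rfl⟩ nofun (hnull _ _)
  · exact single_inherit_mem S₀ nofun ⟨A, false, [], rfl, rfl⟩ hside
      (hP.constantCoeff_eq_zero hw X Z A)

end WLIG

/-! ### The derivation sums of the new grammar -/

namespace WLIG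

open CountablyCompleteSemiring TrimNonterm

variable {T : Type} {K : Type*} {G : WLIG T K} {R : Type*} [CountablyCompleteSemiring R]
  (w : G.rules → R⟦X⟧) (S₀ : G.Γ) (P : G.N → List G.Γ → G.N → R⟦X⟧)

/-- The series that the nonterminals of the new grammar derive, expressed by those of `G`. -/
noncomputable def trimVal : TrimNonterm G.N T → List (G.Γ × Bool) → StringSeries T R⟦X⟧
  | newStart, _ => (X : R⟦X⟧) • symVal w S₀ (.inl G.start) +
      nullWeight w [.nonterm G.start [S₀]] • 1
  | keep Y, τ => StringSeries.pos (G.derivSum w [.nonterm Y (τ.map Prod.fst)])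
  | drain Y s, τ => nullWeight w [.nonterm Y (τ.map Prod.fst)] • symVal w S₀ s

/-- The value of the right-hand side that a production yields for `Z[τ]`. -/
noncomputable def trimEval (Z : TrimNonterm G.N T) (τ : List (G.Γ × Bool))
    (q : TrimProduction G) : StringSeries T R⟦X⟧ :=
  (q.rhs? Z τ).elim 0 (formVal (trimVal w S₀))

open Classical in
theorem trimEval_inherit (Z Z' Y : TrimNonterm G.N T) (τ τ' : List (G.Γ × Bool))
    (B B' : G.Γ × Bool) (l r : List (FormSymbol (TrimNonterm G.N T) T (G.Γ × Bool))) :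
    trimEval w S₀ Z (τ ++ [B]) (.inherit Y [B'] l Z' τ' r) =
      if Y = Z ∧ B' = B then
        formVal (trimVal w S₀) l * trimVal w S₀ Z' (τ ++ τ') * formVal (trimVal w S₀) r
      else 0 := by
  rw [trimEval, Production.rhs?_inherit_concat]
  split_ifs <;> simp [mul_assoc]

open Classical in
theorem trimEval_terminal (Z Y : TrimNonterm G.N T) (τ : List (G.Γ × Bool))
    (B B' : G.Γ × Bool) (a : Option T) :
    trimEval w S₀ Z (τ ++ [B]) (.terminal Y [B'] a) =
      if Y = Z ∧ B' = B ∧ τ = [] then a.elim 1 StringSeries.letter else 0 := by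
  rw [trimEval, Production.rhs?_terminal_concat]
  split_ifs
  · cases a <;> simp
  · rfl

theorem formVal_map_toSym (e : List (G.N ⊕ T)) :
    formVal (trimVal w S₀) (e.map (toSym S₀)) = (e.map (symVal w S₀)).prod := by
  induction e with
  | nil => simp
  | cons s e ih => cases s <;> simp [toSym, trimVal, symVal, ih]

variable {w} (hw : ∀ p, constantCoeff (w p) = 0)
include hw

theorem expand_sum (β : G.Form) (hβ : ∀ Y σ, FormSymbol.nonterm Y σ ∈ β → σ = [S₀]) :
    ((expand w β).sum fun e c => c • (e.map (symVal w S₀)).prod) = G.derivSum w β := by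
  rw [← linearCombination_expand S₀ hw β hβ, Finsupp.linearCombination_apply]

open Classical in
theorem linearCombination_keepRules (c : R⟦X⟧) (X X' Y : G.N) (A B : G.Γ) {l r : G.Form}
    (α ρ : List G.Γ) (b b' : Bool)
    (hlr : ∀ Y σ, FormSymbol.nonterm Y σ ∈ l ++ r → σ = [S₀]) :
    Finsupp.linearCombination R⟦X⟧ (trimEval w S₀ (keep Y) (markBot true ρ ++ [(B, b')]))
        (keepRules w S₀ c X A l X' α r b) =
      if X = Y ∧ A = B ∧ b = b' then
        c • (G.derivSum w l * StringSeries.pos (G.derivSum w [.nonterm X' (ρ ++ α)]) *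
          G.derivSum w r)
      else 0 := by
  simp only [keepRules, map_finsuppSum, Finsupp.linearCombination_single, trimEval_inherit,
    keep.injEq, Prod.mk.injEq, formVal_map_toSym, trimVal, List.map_append, map_fst_markBot]
  split_ifs with h
  · rw [← expand_sum S₀ hw l fun Y σ h => hlr Y σ (List.mem_append_left _ h),
      ← expand_sum S₀ hw r fun Y σ h => hlr Y σ (List.mem_append_right _ h)]
    simp only [Finsupp.sum_mul, Finsupp.mul_sum, Finsupp.smul_sum, smul_mul_assoc, mul_smul_comm,
      mul_smul]
    simp only [Finsupp.sum]
    rw [Finset.sum_comm]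
    exact Finset.sum_congr rfl fun e _ => Finset.sum_congr rfl fun e' _ => by
      rw [smul_comm (expand w l e')]
  · simp

open Classical in
theorem linearCombination_drainRules (c : R⟦X⟧) (X X' Y : G.N) (A B : G.Γ) {l r : G.Form}
    (α ρ : List G.Γ) (b b' : Bool)
    (hlr : ∀ Y σ, FormSymbol.nonterm Y σ ∈ l ++ r → σ = [S₀]) :
    Finsupp.linearCombination R⟦X⟧ (trimEval w S₀ (keep Y) (markBot true ρ ++ [(B, b')]))
        (drainRules w S₀ c X A l X' α r b) =
      if X = Y ∧ A = B ∧ b = b' then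
        c • nullWeight w [.nonterm X' (ρ ++ α)] •
          StringSeries.pos (G.derivSum w l * G.derivSum w r)
      else 0 := by
  rw [drainRules, map_finsuppSum, ← derivSum_append hw, ← expand_sum S₀ hw _ hlr, map_finsuppSum]
  have h (e : List (G.N ⊕ T)) (c' : R⟦X⟧) :
      Finsupp.linearCombination R⟦X⟧ (trimEval w S₀ (keep Y) (markBot true ρ ++ [(B, b')]))
        (drainRule S₀ X A X' α b (c * c') e) =
      if X = Y ∧ A = B ∧ b = b' then
        c • nullWeight w [.nonterm X' (ρ ++ α)] •
          StringSeries.pos (c' • (e.map (symVal w S₀)).prod)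
      else 0 := by
    cases e with
    | nil => simp [drainRule]
    | cons s e =>
      simp only [drainRule, Finsupp.linearCombination_single, trimEval_inherit,
        keep.injEq, Prod.mk.injEq, formVal_map_toSym, trimVal, List.map_append, map_fst_markBot,
        formVal_nil, one_mul, map_smul, List.map_cons, List.prod_cons]
      split_ifs
      · rw [StringSeries.pos_eq_self (by rw [StringSeries.mul_nil, symVal_nil, zero_mul]),
          smul_mul_assoc, mul_smul, smul_comm c']
      · simp
  simp only [h]
  split_ifs
  · simp only [Finsupp.smul_sum]
  · simp

/-- The productions obtained from `p` account for the nonempty strings derived with `p`. -/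
theorem linearCombination_trimRule_keep (hG : G.HasTopDownRules S₀) (p : G.rules) (Y : G.N)
    (B : G.Γ) (ρ : List G.Γ) :
    Finsupp.linearCombination R⟦X⟧
        (trimEval w S₀ (keep Y) (markBot true ρ ++ [(B, ρ.isEmpty)])) (trimRule w S₀ (w p) p.1) =
      w p • StringSeries.pos ((p.1.rhs? Y (ρ ++ [B])).elim 0 (G.derivSum w)) := by
  classical
  rcases hG p.1 p.2 with ⟨X₁, A₁, l, X', α, r, hp, hlr⟩ | ⟨X₁, A₁, a, hp⟩
  · simp only [hp, trimRule, map_sum, map_add, linearCombination_keepRules S₀ hw _ _ _ _ _ _ _ _ _ _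
      hlr, linearCombination_drainRules S₀ hw _ _ _ _ _ _ _ _ _ _ hlr,
      Production.rhs?_inherit_concat]
    by_cases h : X₁ = Y ∧ A₁ = B
    · obtain ⟨rfl, rfl⟩ := h
      simp only [true_and, and_self, if_true, Finset.sum_add_distrib, Finset.sum_ite_eq',
        Finset.mem_univ, Option.elim_some]
      rw [derivSum_append hw, ← List.singleton_append (l := r), derivSum_append hw, ← mul_assoc,
        StringSeries.pos_mul_mul, smul_add]
      rfl
    · have h' (b : Bool) : ¬ (X₁ = Y ∧ A₁ = B ∧ b = ρ.isEmpty) := fun h' => h ⟨h'.1, h'.2.1⟩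
      simp [h, h']
  · rw [hp, Production.rhs?_terminal_concat]
    cases a with
    | none =>
      split_ifs <;> simp [trimRule, derivSum_nil]
    | some a =>
      rw [trimRule, Finsupp.linearCombination_single, trimEval_terminal]
      cases ρ with
      | nil =>
        by_cases h : X₁ = Y ∧ A₁ = B
        · have h1 : StringSeries.pos (StringSeries.letter a : StringSeries T R⟦X⟧) =
              StringSeries.letter a := StringSeries.pos_eq_self (by simp)
          simp [h, markBot, derivSum_term, derivSum_nil, h1]
        · rw [if_neg fun h' => h ⟨keep.inj h'.1, congrArg Prod.fst h'.2.1⟩,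
            if_neg fun h' => h ⟨h'.1, h'.2.1⟩]
          simp
      | cons C ρ => simp [markBot]

omit hw in
theorem linearCombination_trimRule_of_ne (c : R⟦X⟧) (p : Production G.N T G.Γ)
    {Z : TrimNonterm G.N T} (hZ : ∀ Y, keep Y ≠ Z) (τ : List (G.Γ × Bool)) (B : G.Γ × Bool) :
    Finsupp.linearCombination R⟦X⟧ (trimEval w S₀ Z (τ ++ [B])) (trimRule w S₀ c p) = 0 := by
  unfold trimRule
  split
  · simp only [map_sum, map_add, keepRules, drainRules, map_finsuppSum]
    refine Finset.sum_eq_zero fun b _ => ?_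
    rw [Finsupp.sum, Finsupp.sum, Finset.sum_eq_zero, Finset.sum_eq_zero, add_zero]
    · intro e _
      cases e with
      | nil => exact map_zero _
      | cons s e => rw [drainRule, Finsupp.linearCombination_single, trimEval_inherit,
          if_neg fun h => hZ _ h.1, smul_zero]
    · intro e _
      refine Finset.sum_eq_zero fun e' _ => ?_
      dsimp only
      rw [Finsupp.linearCombination_single, trimEval_inherit, if_neg fun h => hZ _ h.1, smul_zero]
  · simp [trimEval_terminal, hZ]
  · simp

variable {P} [Fintype G.N] [Fintype G.Γ] [Fintype T]

omit [Fintype G.Γ] [Fintype T] in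
open Classical in
/-- The productions that pop a stack symbol and those that leave the bottom of the stack together
account for the derivations of the empty string from `Y[ρ B]`. -/
theorem linearCombination_leave_pop (hP : IsPopWeight w P) (hG : G.HasTopDownRules S₀)
    (X Y : G.N) (A B : G.Γ) (s t : G.N ⊕ T) (ρ : List G.Γ) :
    Finsupp.linearCombination R⟦X⟧
        (trimEval w S₀ (drain Y t) (markBot true ρ ++ [(B, ρ.isEmpty)]))
        (leaveRule w S₀ X A s + ∑ Z, popRule P X s A Z) =
      if X = Y ∧ A = B ∧ s = t then nullWeight w [.nonterm Y (ρ ++ [B])] • symVal w S₀ t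
      else 0 := by
  simp only [map_add, map_sum, popRule, Finsupp.linearCombination_single, trimEval_inherit]
  by_cases h : X = Y ∧ A = B ∧ s = t
  · obtain ⟨rfl, rfl, rfl⟩ := h
    rcases eq_or_ne ρ [] with rfl | hρ
    -- At the bottom of the stack only `leaveRule` applies, above it only `popRule`.
    · cases s <;> simp [leaveRule, markBot, trimEval, Production.rhs?, trimVal, symVal]
    · have hρ' : ρ.isEmpty = false := by simpa using hρ
      have hl : Finsupp.linearCombination R⟦X⟧
          (trimEval w S₀ (drain X s) (markBot true ρ ++ [(A, false)]))
          (leaveRule w S₀ X A s) = 0 := by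
        cases s <;> simp [leaveRule, trimEval_inherit, trimEval_terminal]
      rw [hρ', hl, hP.nullWeight_append_stack hw hG hρ]
      simp [trimVal, map_fst_markBot, Finset.sum_smul, mul_smul]
  · have hl : Finsupp.linearCombination R⟦X⟧
        (trimEval w S₀ (drain Y t) (markBot true ρ ++ [(B, ρ.isEmpty)]))
        (leaveRule w S₀ X A s) = 0 := by
      cases s <;> simp only [leaveRule, Finsupp.linearCombination_single, trimEval_inherit,
        trimEval_terminal, drain.injEq, Prod.mk.injEq]
      all_goals
        rw [if_neg (by tauto), smul_zero]
    rw [hl, if_neg h, zero_add]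
    refine Finset.sum_eq_zero fun Z _ => ?_
    simp only [drain.injEq, Prod.mk.injEq]
    rw [if_neg (by tauto), smul_zero]

omit hw [Fintype G.Γ] [Fintype T] in
theorem linearCombination_leave_pop_of_ne (X : G.N) (A : G.Γ) (s : G.N ⊕ T)
    {Z : TrimNonterm G.N T} (hZ : ∀ Y t, drain Y t ≠ Z) (τ : List (G.Γ × Bool))
    (B : G.Γ × Bool) :
    Finsupp.linearCombination R⟦X⟧ (trimEval w S₀ Z (τ ++ [B]))
      (leaveRule w S₀ X A s + ∑ Z, popRule P X s A Z) = 0 := by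
  cases s <;> simp [leaveRule, popRule, trimEval_inherit, trimEval_terminal, hZ]

omit hw [Fintype G.N] [Fintype G.Γ] [Fintype T] in
theorem linearCombination_startRules_of_ne {Z : TrimNonterm G.N T} (hZ : newStart ≠ Z)
    (τ : List (G.Γ × Bool)) (B : G.Γ × Bool) :
    Finsupp.linearCombination R⟦X⟧ (trimEval w S₀ Z (τ ++ [B])) (startRules w S₀) = 0 := by
  simp [startRules, trimEval_inherit, trimEval_terminal, hZ]

/-- The stacks on which the nonterminals of the new grammar occur in derivations. -/
def TrimDomain (S₀ : G.Γ) (Z : TrimNonterm G.N T) (τ : List (G.Γ × Bool)) : Prop :=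
  (∃ σ, τ = markBot true σ) ∧ (Z = newStart → τ = [(S₀, true)])

/-- `trimVal` solves the system of equations given by the productions of the new grammar. -/
theorem linearCombination_trimRules (hP : IsPopWeight w P) (hG : G.HasTopDownRules S₀)
    {Z : TrimNonterm G.N T} {τ : List (G.Γ × Bool)} (hZ : TrimDomain S₀ Z τ) :
    Finsupp.linearCombination R⟦X⟧ (trimEval w S₀ Z τ) (trimRules w S₀ P) =
      trimVal w S₀ Z τ := by
  classical
  obtain ⟨⟨σ, rfl⟩, hZ⟩ := hZ
  rcases List.eq_nil_or_concat' σ with rfl | ⟨ρ, B, rfl⟩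
  · -- No production applies to an empty stack.
    have hnil (X : G.N) : G.derivSum w [.nonterm X []] = 0 := by
      rw [derivSum_nonterm']
      refine Finset.sum_eq_zero fun p _ => ?_
      rcases hG p.1 p.2 with ⟨X₁, A₁, l, X', α, r, hp, -⟩ | ⟨X₁, A₁, a, hp⟩
      · simp [hp, Production.rhs?_inherit_nil]
      · simp [hp, Production.rhs?_terminal_nil]
    have hv : trimVal w S₀ Z (markBot true []) = 0 := by
      cases Z with
      | newStart => exact absurd (hZ rfl) (by simp [markBot])
      | keep Y => simp [trimVal, markBot, hnil]
      | drain Y s => simp [trimVal, markBot, nullWeight, hnil]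
    rw [hv, Finsupp.linearCombination_apply]
    refine Finset.sum_eq_zero fun q hq => ?_
    have hq := (trimRules_mem hw hP q).1 (Finsupp.mem_support_iff.1 hq)
    cases q with
    | inherit Y τ l X' τ' r =>
      obtain ⟨-, ⟨A, b, α, rfl, -⟩, -⟩ := hq
      simp [trimEval, markBot, Production.rhs?_inherit_nil]
    | terminal Y τ a =>
      obtain ⟨⟨A, rfl⟩, -⟩ := hq
      simp [trimEval, markBot, Production.rhs?_terminal_nil]
  · have hm := markBot_concat ρ B
    cases Z with
    | newStart =>
      have hτ := hZ rfl
      rw [hτ, ← List.nil_append [(S₀, true)], trimRules, map_add, map_add, map_sum, map_sum]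
      simp only [linearCombination_trimRule_of_ne S₀ _ _ (Z := newStart) nofun, map_sum,
        linearCombination_leave_pop_of_ne S₀ _ _ _ (Z := newStart) nofun]
      simp [startRules, trimEval, Production.rhs?, trimVal, symVal]
    | keep Y =>
      rw [hm, trimRules, map_add, map_add, map_sum, map_sum,
        linearCombination_startRules_of_ne S₀ (Z := keep Y) nofun]
      simp only [linearCombination_trimRule_keep S₀ hw hG, map_sum,
        linearCombination_leave_pop_of_ne S₀ _ _ _ (Z := keep Y) nofun, Finset.sum_const_zero]
      rw [← hm, trimVal, map_fst_markBot, derivSum_nonterm', map_sum, zero_add, add_zero]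
      simp only [map_smul]
    | drain Y t =>
      rw [hm, trimRules, map_add, map_add, map_sum, map_sum,
        linearCombination_startRules_of_ne S₀ (Z := drain Y t) nofun]
      simp only [linearCombination_trimRule_of_ne S₀ _ _ (Z := drain Y t) nofun, map_sum,
        linearCombination_leave_pop S₀ hw hP hG, Finset.sum_const_zero]
      rw [← hm, trimVal, map_fst_markBot]
      simp [ite_and]

variable (w P)

omit hw in
/-- The grammar without nullary productions, with its weights mapped to `K` by `φ`. -/
noncomputable def trim (φ : R⟦X⟧ → K) : WLIG T K where
  N := TrimNonterm G.N T
  Γ := G.Γ × Bool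
  finite_N := inferInstance
  finite_Γ := inferInstance
  rules := (trimRules w S₀ P).support
  start := newStart
  initStack := [(S₀, true)]
  weight p := φ (trimRules w S₀ P p.1)

variable {w P}

theorem isTrimRule_of_mem (hP : IsPopWeight w P) (φ : R⟦X⟧ → K) :
    ∀ p ∈ (trim w S₀ P φ).rules, IsTrimRule S₀ p := fun p hp =>
  (trimRules_mem hw hP p).1 (Finsupp.mem_support_iff.1 hp)

/-- The derivation sums of the new grammar are those of `G`, except that on nonempty strings they
have an additional factor `X` for the start production. -/
theorem derivSum_trim (hP : IsPopWeight w P) (hG : G.HasTopDownRules S₀) (φ : R⟦X⟧ → K) :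
    (trim w S₀ P φ).derivSum (fun p => trimRules w S₀ P p.1) (trim w S₀ P φ).initForm =
      (X : R⟦X⟧) • StringSeries.pos (G.derivSum w [.nonterm G.start [S₀]]) +
        nullWeight w [.nonterm G.start [S₀]] • 1 := by
  have h := derivSum_eq_formVal (G := trim w S₀ P φ) (w := fun p => trimRules w S₀ P p.1)
    (fun p => (trimRules_mem hw hP p.1).2) (TrimDomain S₀) ?_ (trimVal w S₀) ?_
    (trim w S₀ P φ).initForm ?_
  · rw [h]
    change trimVal w S₀ newStart _ * 1 = _
    rw [mul_one]
    rfl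
  · intro p hp X σ γ hX hγ Y τ hY
    obtain ⟨⟨σ, rfl⟩, -⟩ := hX
    have hp := isTrimRule_of_mem S₀ hw hP φ p hp
    cases p with
    | inherit X₁ τ₁ l X' τ' r =>
      obtain ⟨hX', ⟨A, b, α, rfl, rfl⟩, hside⟩ := hp
      rcases List.eq_nil_or_concat' σ with rfl | ⟨ρ, B, rfl⟩
      · cases (Production.rhs?_inherit_nil _ _ _ _ _ _ _).symm.trans hγ
      · rw [markBot_concat] at hγ
        replace hγ := (Production.rhs?_inherit_concat _ _ _ _ _ _ _ _ _).symm.trans hγ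
        obtain ⟨⟨rfl, hAB⟩, rfl⟩ := by
          simpa only [Option.ite_none_right_eq_some, Option.some.injEq] using hγ
        cases hAB
        rcases List.mem_append.1 hY with hY | hY
        · obtain ⟨h1, rfl⟩ := hside Y τ (List.mem_append_left _ hY)
          exact ⟨⟨[S₀], rfl⟩, fun h => absurd h h1⟩
        · rcases List.mem_cons.1 hY with hY | hY
          · cases hY
            exact ⟨⟨ρ ++ α, markBot_append ρ α⟩, fun h => absurd h hX'⟩
          · obtain ⟨h1, rfl⟩ := hside Y τ (List.mem_append_right _ hY)
            exact ⟨⟨[S₀], rfl⟩, fun h => absurd h h1⟩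
    | terminal X₁ τ₁ a =>
      have hγ : _ = some γ := hγ
      simp only [Production.rhs?, Option.ite_none_right_eq_some, Option.some.injEq] at hγ
      obtain ⟨-, rfl⟩ := hγ
      simp at hY
  · intro Z τ hZ
    rw [← linearCombination_trimRules S₀ hw hP hG hZ, Finsupp.linearCombination_apply]
    exact (Finset.sum_coe_sort (trimRules w S₀ P).support
      fun q => trimRules w S₀ P q • trimEval w S₀ Z τ q).symm
  · intro Y τ h
    cases List.mem_singleton.1 h
    exact ⟨⟨[S₀], rfl⟩, fun _ => rfl⟩

end WLIG

/-! ### Weak equivalence -/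

namespace WLIG

open CountablyCompleteSemiring

variable {T : Type} {K : Type*}

/-- At `X = 1` the factor `X` of the start production disappears. -/
theorem evalOne_smul_pos_add_smul_one {R : Type*} [CountablyCompleteSemiring R]
    (f : StringSeries T R⟦X⟧) (y : List T) :
    evalOne (((X : R⟦X⟧) • StringSeries.pos f + f [] • 1) y) = evalOne (f y) := by
  cases y <;> simp [evalOne_X]

end WLIG

open CountablyCompleteSemiring in
theorem mainTheorem6 {K : Type*} [CountablyCompleteSemiring K] {T : Type} [Finite T]
    (G : WLIG T K) (hG : G.IsTopDown) :
    ∃ G' : WLIG T K, G'.IsTopDown ∧ G.WeaklyEquivalent G' ∧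
      (∀ p ∈ G'.rules, p.IsNullary → p = .terminal G'.start G'.initStack none) ∧
      (∀ p ∈ G'.rules, ¬ p.OccursOnRight G'.start) ∧
      ([] ∉ G.language → ∀ p ∈ G'.rules, ¬ p.IsNullary) := by
  obtain ⟨S₀, hinit, hrules⟩ := hG
  have hrules : G.HasTopDownRules S₀ := hrules
  let _ : Fintype G.N := @Fintype.ofFinite _ G.finite_N
  let _ : Fintype G.Γ := @Fintype.ofFinite _ G.finite_Γ
  let _ : Fintype T := Fintype.ofFinite T
  let w : G.rules → (WithZero K)⟦X⟧ := fun p => C (G.weight p : WithZero K) * X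
  have hw (p : G.rules) : constantCoeff (w p) = 0 := by simp [w]
  have heval (p : G.rules) : evalOne (w p) = G.weight p := evalOne_C_mul_X _
  have hw0 (p : G.rules) : w p ≠ 0 := fun h => by simpa [h] using (heval p).symm
  obtain ⟨P, hP⟩ := WLIG.exists_isPopWeight hw
  let φ : (WithZero K)⟦X⟧ →+* K := unzero.comp evalOne
  have hφ {ι : Type} [Countable ι] (f : ι → (WithZero K)⟦X⟧) :
      φ (csum f) = csum fun i => φ (f i) := by
    simp only [φ, RingHom.comp_apply, evalOne_csum, unzero_csum]
  let G' := WLIG.trim w S₀ P φ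
  let w' : G'.rules → (WithZero K)⟦X⟧ := fun p => WLIG.trimRules w S₀ P p.1
  have hw0' (p : G'.rules) : w' p ≠ 0 := Finsupp.mem_support_iff.1 p.2
  have hform : G.initForm = [.nonterm G.start [S₀]] := by rw [WLIG.initForm, hinit]
  have hsum (y : List T) :
      evalOne (G.derivSum w G.initForm y) = evalOne (G'.derivSum w' G'.initForm y) := by
    rw [WLIG.derivSum_trim S₀ hw hP hrules φ, hform]
    exact (WLIG.evalOne_smul_pos_add_smul_one _ y).symm
  have hlang : G.language = G'.language := by
    ext y
    rw [WLIG.mem_language_iff_derivSum_ne_zero hw0, WLIG.mem_language_iff_derivSum_ne_zero hw0',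
      ne_eq, ne_eq, ← evalOne_eq_zero, hsum, evalOne_eq_zero]
  have hG' := WLIG.isTrimRule_of_mem S₀ hw hP φ
  have hnull : ∀ p ∈ G'.rules, p.IsNullary → p = .terminal G'.start G'.initStack none := by
    rintro p hp ⟨X, A, rfl⟩
    obtain ⟨hX, hA⟩ := (hG' _ hp).2 rfl
    rw [hX, hA]
    rfl
  refine ⟨G', ⟨(S₀, true), rfl, fun p hp => ?_⟩, ⟨hlang, fun y => ?_⟩, hnull, fun p hp h => ?_,
    fun hε p hp h => hε ?_⟩
  · have h := hG' p hp
    cases p with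
    | inherit X τ l X' τ' r =>
      obtain ⟨-, ⟨A, b, α, rfl, -⟩, hside⟩ := h
      exact .inl ⟨X, (A, b), l, X', _, r, rfl, fun Y σ h => (hside Y σ h).2⟩
    | terminal X τ a =>
      obtain ⟨⟨B, rfl⟩, -⟩ := h
      exact .inr ⟨X, B, a, rfl⟩
  · have h := congrArg unzero (hsum y)
    change φ _ = φ _ at h
    rw [WLIG.map_derivSum w φ hφ, WLIG.map_derivSum w' φ hφ] at h
    have hwt : (fun p => φ (w p)) = G.weight := funext fun p => by
      simp only [φ, RingHom.comp_apply, heval, unzero_coe]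
    rw [hwt] at h
    exact h
  · cases p with
    | inherit X τ l X' τ' r =>
      obtain ⟨hX', -, hside⟩ := hG' _ hp
      rcases h with h | ⟨σ, h⟩
      · exact hX' h.symm
      · exact (hside _ _ h).1 rfl
    | terminal X τ a => exact h
  · -- A nullary production of the new grammar derives the empty string in one step.
    rw [hlang, WLIG.mem_language_iff]
    obtain rfl := hnull p hp h
    refine ⟨[⟨_, hp⟩], WLIG.leftmostDerives_nonterm_iff.2 ⟨_, [], [], rfl, ?_, .nil []⟩⟩
    simp [Production.rhs?]
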